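/- Let $m\in\mathbb N$ and $S=\{0,1,\dots,m\}$, $S^0=\{1,\dots,m\}$. Let $H_k,p_k,c_k\in(0,1)$ for $k\in S^0$, put $p_0=1-\sum_{k=1}^m p_k$, and assume that for all times $i_0<i_1<i_2$ in $\mathbb N$ $$\sum_{k=1}^{m}\frac{(p_k+c_k|i_1-i_0|^{2H_k-2})(p_k+c_k|i_2-i_1|^{2H_k-2})}{p_k+c_k|i_2-i_0|^{2H_k-2}}<1 .$$ For a finite set $A=\{i_0<i_1<\dots<i_n\}\subset\mathbb N$ let $L_k^*(A)=p_k\prod_{j=1}^n\bigl(p_k+c_k|i_j-i_{j-1}|^{2H_k-2}\bigr)$, and $L_k^*(\emptyset)=1$. For finite pairwise disjoint $A_0,A_1,\dots,A_m\subset\mathbb N$ with $A_0\neq\emptyset$ let $$\mathbf D^*(A_1,\dots,A_m;A_0)=\sum_{\ell=0}^{|A_0|}(-1)^\ell\sum_{\substack{B\subset A_0\\|B|=\ell}}\ \sum_{\substack{B_1,\dots,B_m\text{ pairwise disjoint}\\ B_1\cup\dots\cup B_m=B}}\ \prod_{k=1}^m L_k^*(A_k\cup B_k).$$ **Theorem.**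 There is a process $\{X_i\}_{i\in\mathbb N}$ with values in $S$ such that, for all finite pairwise disjoint $A_0,\dots,A_m\subset\mathbb N$ with $A_0\ne\emptyset$, $$P\Bigl(\bigcap_{i\in A_k}\{X_i=k\}\Bigr)=L_k^*(A_k)\ \ (k\in S^0),\qquad P\Bigl(\bigcap_{k=1}^m\bigcap_{i\in A_k}\{X_i=k\}\Bigr)=\prod_{k=1}^mL_k^*(A_k),$$ $$P\Bigl(\bigcap_{k=0}^m\bigcap_{i\in A_k}\{X_i=k\}\Bigr)=\mathbf D^*(A_1,\dots,A_m;A_0).$$ Every such process is (strictly) stationary, the indicator sequence $\{I_{\{X_i=k\}}\}_i$ of each state $k\in S$ is stationary, and the following hold. i. $P(X_i=k)=p_k$ for all $i$ and all $k\in S$. ii. For $k\in S^0$ and $i\neq j$, $\mathrm{cov}(I_{\{X_i=k\}},I_{\{X_j=k\}})=p_kc_k|i-j|^{2H_k-2}$. If $k'\in S^0$ is the unique maximizer of $k\mapsto H_k$, then $$\mathrm{cov}(I_{\{X_i=0\}},I_{\{X_j=0\}})\sim p_{k'}c_{k'}|i-j|^{2H_{k'}-2}\quad\text{as }|i-j|\to\infty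 ;$$ if there are several maximizers and $k'$ is one of them, the same holds with $p_{k'}c_{k'}$ replaced by $\sum_{k:\,H_k=H_{k'}}p_kc_k$. iii. For $i\ne j$, $\mathrm{cov}(X_i,X_j)=\sum_{k=1}^mk^2p_kc_k|i-j|^{2H_k-2}$. Consequently each state can have its own Hurst index. Call a real stationary sequence $Y_1,Y_2,\dots$ long-range dependent if $\sum_n\mathrm{cov}(Y_1,Y_n)$ is not (absolutely) convergent, and let its Hurst index be $\inf\{h:\limsup_n n^{-2h+1}\sum_{j=1}^n\mathrm{cov}(Y_1,Y_j)<\infty\}$. If $k\in S^0$ and $H_k>1/2$, then $\{I_{\{X_i=k\}}\}$ is long-range dependent with Hurst index $H_k$. If $\max_kH_k>1/2$, then $\{X_i\}$ and $\{I_{\{X_i=0\}}\}$ are long-range dependent with Hurst index $\max_kH_k$. -/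

import Mathlib

open MeasureTheory ProbabilityTheory Filter
open scoped Topology

noncomputable section

/-- The factor `p + c |j - i|^(2H-2)` attached to two successive times `i`, `j`. -/
def gapWeight (H p c : ℝ) (i j : ℕ) : ℝ :=
  p + c * |(j : ℝ) - (i : ℝ)| ^ (2 * H - 2)

/-- The factor contributed by `i ∈ A`: it is `gapWeight H p c j i` if `j` is the predecessor
of `i` in `A`, and it is `p` if `i` is the smallest element of `A`. -/
def stepWeight (H p c : ℝ) (A : Finset ℕ) (i : ℕ) : ℝ :=
  if h : (A.filter (fun j => j < i)).Nonempty then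
    gapWeight H p c ((A.filter (fun j => j < i)).max' h) i
  else p

/-- `L*_{H,p,c}(A) = p ∏_{j=1}^n (p + c |i_j - i_{j-1}|^(2H-2))` for
`A = {i_0 < i_1 < ... < i_n}`, and `L*_{H,p,c}(∅) = 1`. -/
def LStar (H p c : ℝ) (A : Finset ℕ) : ℝ :=
  ∏ i ∈ A, stepWeight H p c A i

/-- `L*_{H,p,c}(A_1, ..., A_m) = ∏_k L*_{H_k,p_k,c_k}(A_k)`; the state `k ∈ {1, ..., m}` is
represented by the element `k - 1` of `Fin m`. -/
def LStarVec {m : ℕ} (H p c : Fin m → ℝ) (A : Fin m → Finset ℕ) : ℝ :=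
  ∏ k, LStar (H k) (p k) (c k) (A k)

/-- All ordered families `(B_1, ..., B_m)` of pairwise disjoint, possibly empty, sets with
union `B`. -/
def splittings (m : ℕ) (B : Finset ℕ) : Finset (Fin m → Finset ℕ) :=
  (Fintype.piFinset (fun _ : Fin m => B.powerset)).filter
    (fun F => (∀ k l, k ≠ l → Disjoint (F k) (F l)) ∧ Finset.univ.biUnion F = B)

/-- `D*_{H,p,c}(A_1, ..., A_m; A_0)`, the inclusion-exclusion sum
`∑_ℓ (-1)^ℓ ∑_{B ⊆ A_0, |B| = ℓ} ∑_{(B_k)} L*(A_1 ∪ B_1, ..., A_m ∪ B_m)`. -/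
def DStar {m : ℕ} (H p c : Fin m → ℝ) (A : Fin m → Finset ℕ) (A0 : Finset ℕ) : ℝ :=
  ∑ l ∈ Finset.range (A0.card + 1), (-1 : ℝ) ^ l *
    ∑ B ∈ A0.powersetCard l, ∑ F ∈ splittings m B, LStarVec H p c (fun k => A k ∪ F k)

/-- The process `X` with states `{0, ..., m}` has the prescribed finite-dimensional
probabilities. -/
structure HasFiniteDimLaw {m : ℕ} (H p c : Fin m → ℝ) {Ω : Type*} [MeasurableSpace Ω]
    (P : Measure Ω) (X : ℕ → Ω → Fin (m + 1)) : Prop where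
  single : ∀ (k : Fin m) (A : Finset ℕ),
    P.real {ω | ∀ i ∈ A, X i ω = k.succ} = LStar (H k) (p k) (c k) A
  positive : ∀ A : Fin m → Finset ℕ, (∀ k l, k ≠ l → Disjoint (A k) (A l)) →
    P.real {ω | ∀ k, ∀ i ∈ A k, X i ω = k.succ} = ∏ k, LStar (H k) (p k) (c k) (A k)
  joint : ∀ (A0 : Finset ℕ) (A : Fin m → Finset ℕ), A0.Nonempty →
    (∀ k, Disjoint A0 (A k)) → (∀ k l, k ≠ l → Disjoint (A k) (A l)) →
    P.real {ω | (∀ i ∈ A0, X i ω = 0) ∧ ∀ k, ∀ i ∈ A k, X i ω = k.succ} = DStar H p c A A0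

/-- Strict stationarity: all finite-dimensional distributions are invariant under shifts. -/
def IsStationaryProcess {Ω E : Type*} [MeasurableSpace Ω] [MeasurableSpace E]
    (P : Measure Ω) (Y : ℕ → Ω → E) : Prop :=
  ∀ (n : ℕ) (t : Fin n → ℕ) (h : ℕ),
    IdentDistrib (fun ω r => Y (t r + h) ω) (fun ω r => Y (t r) ω) P P

/-- The indicator sequence of the state `a`. -/
def stateIndicator {Ω S : Type*} (X : ℕ → Ω → S) (a : S) (i : ℕ) : Ω → ℝ :=
  Set.indicator {ω | X i ω = a} (fun _ => 1)

/-- The process regarded as real valued. -/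
def realProcess {m : ℕ} {Ω : Type*} (X : ℕ → Ω → Fin (m + 1)) (i : ℕ) (ω : Ω) : ℝ :=
  ((X i ω : ℕ) : ℝ)

/-- `η` is the Hurst index of a second order stationary process, that is the infimum of all `h`
with `limsup_n n^(1-2h) ∑_{j=1}^n cov(Y_1, Y_j) < ∞` (times are counted from `0` here). -/
def IsHurstIndex {Ω : Type*} [MeasurableSpace Ω] (P : Measure Ω) (Y : ℕ → Ω → ℝ) (η : ℝ) :
    Prop :=
  IsGLB {h : ℝ | limsup (fun n : ℕ =>
    (((n : ℝ) ^ (-2 * h + 1) * ∑ j ∈ Finset.range n, cov[Y 0, Y j; P] : ℝ) : EReal)) atTop < ⊤} η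

/-- Long-range dependence: the covariance function of a stationary process is not summable. -/
def IsLongRangeDependent {Ω : Type*} [MeasurableSpace Ω] (P : Measure Ω) (Y : ℕ → Ω → ℝ) :
    Prop :=
  ¬ Summable (fun n : ℕ => cov[Y 0, Y n; P])

/-- The filter `|i - j| → ∞` on pairs of times. -/
def lagAtTop : Filter (ℕ × ℕ) :=
  comap (fun q : ℕ × ℕ => |(q.1 : ℝ) - (q.2 : ℝ)|) atTop

end

/-! ### Gap weights and the effect of inserting one time -/

/-! Existence comes down to nonnegativity of the inclusion-exclusion sums. Adding a time `w` to a
set `A` multiplies `L*(A)` by `insertRatio`, that is g(x)g(y)/g(x+y), where x, y are the gaps from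
`w` to its neighbours in `A` and g is `gapWeightTop`. Since g is log-convex, the ratio decreases in
each gap (`gapRatio_le`). It is therefore largest for x = y = 1, and the hypothesis at the times 0,
1, 2 makes the ratios of all states sum to at most 1 (`insertRatio_le`).

Let `w` be the latest required zero. The mass with this zero is the mass M without it, minus, over
all k, the mass with `w` in state k. By `signedMass_addTime_le` each subtracted mass is at most the
insertion ratio times M, so the difference is nonnegative. That lemma treats the earlier zeros one
at a time, latest first, by writing "z is in state 0" as "z is in no state other than k" minus "z is
in state k". In the first term the constraint at z no longer concerns k. In the second, z separates
`w` from all zeros not yet treated, so inserting `w` gives an exact factor; it is at least the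
original ratio because a neighbour can only have come closer, and the mass it multiplies is
nonnegative by induction. The splitting produces constraints that forbid only some states, so
`signedMass_nonneg` covers these too.

Nonnegative masses are assembled, one time after another, into a measure for each finite horizon,
and compactness of the space of probability measures on sequences yields the process. Conversely,
the probabilities of the positive states determine all others by inclusion-exclusion
(`joint_of_positive`) and depend only on gaps, whence stationarity. Distinct positive states at
distinct times are uncorrelated, so the covariance of any function of the process is a nonnegative
combination of powers of the lag (`HasFiniteDimLaw.covariance_comp`), and the largest exponent that
occurs decides the asymptotics. -/

/-- The weight of a gap of length `n ∈ ℕ∞`; a missing neighbour is a gap of infinite length. -/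
noncomputable def gapWeightTop (H p c : ℝ) : ℕ∞ → ℝ
  | ⊤ => p
  | (n : ℕ) => p + c * (n : ℝ) ^ (2 * H - 2)

section GapWeight

variable {H p c : ℝ}

@[simp] lemma gapWeightTop_top : gapWeightTop H p c ⊤ = p := rfl

@[simp] lemma gapWeightTop_coe (n : ℕ) :
    gapWeightTop H p c (n : ℕ∞) = p + c * (n : ℝ) ^ (2 * H - 2) := rfl

lemma gapWeightTop_pos (hp : 0 < p) (hc : 0 < c) (x : ℕ∞) : 0 < gapWeightTop H p c x := by
  induction x using ENat.recTopCoe with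
  | top => simpa
  | coe n => rw [gapWeightTop_coe]; positivity

lemma gapWeight_eq_gapWeightTop {i j : ℕ} (hij : i ≤ j) :
    gapWeight H p c i j = gapWeightTop H p c ((j - i : ℕ) : ℕ∞) := by
  rw [gapWeight, gapWeightTop_coe, Nat.cast_sub hij, abs_of_nonneg]
  exact sub_nonneg.2 (Nat.cast_le.2 hij)

/-- Powers with `s ≤ 0` reverse the inequality `x * (x' + y) ≤ x' * (x + y)`. -/
lemma rpow_gap_logConvex {s x x' y : ℝ} (hs : s ≤ 0) (hx : 0 < x) (hxx : x ≤ x') (hy : 0 ≤ y) :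
    x' ^ s * (x + y) ^ s ≤ x ^ s * (x' + y) ^ s := by
  have hx' : 0 < x' := hx.trans_le hxx
  rw [← Real.mul_rpow hx'.le (by positivity), ← Real.mul_rpow hx.le (by positivity)]
  refine Real.rpow_le_rpow_of_nonpos (by positivity) ?_ hs
  nlinarith

/-- Put a = `x ^ s`. Both powers on the left are at most a, so (a - `x' ^ s`)(a - `(x + y) ^ s`) ≥
0. Expand, bound the product of the two powers by `rpow_gap_logConvex`, and divide by a. -/
lemma rpow_gap_convex {s x x' y : ℝ} (hs : s ≤ 0) (hx : 0 < x) (hxx : x ≤ x') (hy : 0 ≤ y) :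
    x' ^ s + (x + y) ^ s ≤ x ^ s + (x' + y) ^ s := by
  have h1 := rpow_gap_logConvex hs hx hxx hy
  have ha : 0 < x ^ s := Real.rpow_pos_of_pos hx s
  have h2 : x' ^ s ≤ x ^ s := Real.rpow_le_rpow_of_nonpos hx hxx hs
  have h3 : (x + y) ^ s ≤ x ^ s := Real.rpow_le_rpow_of_nonpos hx (by linarith) hs
  have h4 := mul_nonneg (sub_nonneg.2 h2) (sub_nonneg.2 h3)
  by_contra! h
  nlinarith [mul_lt_mul_of_pos_left h ha]

/-- The bound `1 ≤ x` matters: 0 to a negative power is 0 in Lean, so the weight of the gap 0 is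
only `p`. -/
lemma gapWeightTop_antitone (hH : H < 1) (hc : 0 < c) {x y : ℕ∞} (hx : 1 ≤ x) (hxy : x ≤ y) :
    gapWeightTop H p c y ≤ gapWeightTop H p c x := by
  induction x using ENat.recTopCoe with
  | top => rw [top_le_iff.1 hxy]
  | coe n =>
    have hn : (0 : ℝ) < n := by
      have : 1 ≤ n := by exact_mod_cast hx
      exact_mod_cast this
    induction y using ENat.recTopCoe with
    | top =>
      simp only [gapWeightTop_coe, gapWeightTop_top]
      have : 0 ≤ c * (n : ℝ) ^ (2 * H - 2) := by positivity
      linarith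
    | coe k =>
      have hnk : (n : ℝ) ≤ k := by exact_mod_cast hxy
      simp only [gapWeightTop_coe]
      have := Real.rpow_le_rpow_of_nonpos hn hnk (by linarith : 2 * H - 2 ≤ 0)
      gcongr

/-- After expansion the `p ^ 2` terms cancel, the `p * c` terms compare by convexity and the `c ^ 2`
terms by log-convexity. When `x'` or `y` is infinite, monotonicity suffices. -/
lemma gapWeightTop_logConvex (hH : H < 1) (hp : 0 < p) (hc : 0 < c) {x x' y : ℕ∞}
    (hx : 1 ≤ x) (hxx : x ≤ x') :
    gapWeightTop H p c x' * gapWeightTop H p c (x + y) ≤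
      gapWeightTop H p c x * gapWeightTop H p c (x' + y) := by
  induction x' using ENat.recTopCoe with
  | top =>
    rw [top_add, mul_comm]
    exact mul_le_mul_of_nonneg_right (gapWeightTop_antitone hH hc hx le_self_add)
      (gapWeightTop_pos hp hc _).le
  | coe k =>
    induction y using ENat.recTopCoe with
    | top =>
      simp only [add_top]
      exact mul_le_mul_of_nonneg_right (gapWeightTop_antitone hH hc hx hxx)
        (gapWeightTop_pos hp hc _).le
    | coe l =>
      lift x to ℕ using ne_top_of_le_ne_top (ENat.natCast_ne_top k) hxx
      have hn : (0 : ℝ) < x := by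
        have : 1 ≤ x := by exact_mod_cast hx
        exact_mod_cast this
      have hnk : (x : ℝ) ≤ k := by exact_mod_cast hxx
      have hcoe : ∀ a b : ℕ, gapWeightTop H p c ((a : ℕ∞) + b) =
          p + c * ((a : ℝ) + b) ^ (2 * H - 2) := fun a b => by
        rw [← Nat.cast_add, ← Nat.cast_add, gapWeightTop_coe]
      simp only [gapWeightTop_coe, hcoe]
      have hs : 2 * H - 2 ≤ 0 := by linarith
      have h1 := rpow_gap_logConvex hs hn hnk (Nat.cast_nonneg l)
      have h2 := rpow_gap_convex hs hn hnk (Nat.cast_nonneg l)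
      have h3 := mul_le_mul_of_nonneg_left h1 (mul_pos hc hc).le
      have h4 := mul_le_mul_of_nonneg_left h2 (mul_pos hp hc).le
      nlinarith

end GapWeight

/-- The distance from `w` to the preceding element of `A`. -/
noncomputable def predGap (A : Finset ℕ) (w : ℕ) : ℕ∞ :=
  (A.filter (fun j => j < w)).inf (fun j => ((w - j : ℕ) : ℕ∞))

/-- The distance from `w` to the following element of `A`. -/
noncomputable def succGap (A : Finset ℕ) (w : ℕ) : ℕ∞ :=
  (A.filter (fun j => w < j)).inf (fun j => ((j - w : ℕ) : ℕ∞))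

lemma predGap_insert (A : Finset ℕ) (z w : ℕ) :
    predGap (insert z A) w =
      if z < w then min ((w - z : ℕ) : ℕ∞) (predGap A w) else predGap A w := by
  rw [predGap, Finset.filter_insert]
  split_ifs with h
  · rw [Finset.inf_insert]; rfl
  · rfl

lemma predGap_le {A : Finset ℕ} {v w : ℕ} (hv : v ∈ A) (hvw : v < w) :
    predGap A w ≤ ((w - v : ℕ) : ℕ∞) :=
  Finset.inf_le (f := fun j => ((w - j : ℕ) : ℕ∞)) (Finset.mem_filter.2 ⟨hv, hvw⟩)

lemma one_le_predGap (A : Finset ℕ) (w : ℕ) : 1 ≤ predGap A w := by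
  refine Finset.le_inf fun j hj => ?_
  have := (Finset.mem_filter.1 hj).2
  exact_mod_cast (by omega : 1 ≤ w - j)

lemma one_le_succGap (A : Finset ℕ) (w : ℕ) : 1 ≤ succGap A w := by
  refine Finset.le_inf fun j hj => ?_
  have := (Finset.mem_filter.1 hj).2
  exact_mod_cast (by omega : 1 ≤ j - w)

lemma stepWeight_eq (H p c : ℝ) (A : Finset ℕ) (i : ℕ) :
    stepWeight H p c A i = gapWeightTop H p c (predGap A i) := by
  rw [stepWeight]
  split_ifs with h
  · have hmem := Finset.mem_filter.1 (Finset.max'_mem _ h)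
    rw [gapWeight_eq_gapWeightTop hmem.2.le]
    congr 1
    refine le_antisymm (Finset.le_inf fun j hj => ?_) (predGap_le hmem.1 hmem.2)
    have := Finset.le_max' _ j hj
    exact_mod_cast (by omega : i - (A.filter (fun j => j < i)).max' h ≤ i - j)
  · rw [predGap, Finset.not_nonempty_iff_eq_empty.1 h]
    simp

/-- The factor by which `L*(A)` changes when the time `w` is added to `A`. -/
noncomputable def insertRatio (H p c : ℝ) (A : Finset ℕ) (w : ℕ) : ℝ :=
  gapWeightTop H p c (predGap A w) * gapWeightTop H p c (succGap A w) /
    gapWeightTop H p c (predGap A w + succGap A w)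

section InsertRatio

variable {H p c : ℝ}

lemma LStar_pos (hp : 0 < p) (hc : 0 < c) (A : Finset ℕ) : 0 < LStar H p c A :=
  Finset.prod_pos fun i _ => by rw [stepWeight_eq]; exact gapWeightTop_pos hp hc _

/-- Only two factors are affected: `w` gains one, and the successor of `w` has its gap cut in two.
-/
lemma LStar_insert (hp : 0 < p) (hc : 0 < c) {A : Finset ℕ} {w : ℕ} (hw : w ∉ A) :
    LStar H p c (insert w A) = insertRatio H p c A w * LStar H p c A := by
  simp only [LStar, stepWeight_eq]
  rw [Finset.prod_insert hw, predGap_insert, if_neg (lt_irrefl w), insertRatio]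
  by_cases h : (A.filter (fun j => w < j)).Nonempty
  · set b := (A.filter (fun j => w < j)).min' h with hb
    obtain ⟨hbA, hwb⟩ := Finset.mem_filter.1 (Finset.min'_mem _ h)
    rw [← hb] at hbA hwb
    have hmin : ∀ j ∈ A, w < j → b ≤ j := fun j hj hwj =>
      Finset.min'_le _ _ (Finset.mem_filter.2 ⟨hj, hwj⟩)
    have hsucc : succGap A w = ((b - w : ℕ) : ℕ∞) := by
      refine le_antisymm (Finset.inf_le (f := fun j => ((j - w : ℕ) : ℕ∞))
        (Finset.min'_mem _ h)) (Finset.le_inf fun j hj => ?_)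
      have := hmin j (Finset.mem_filter.1 hj).1 (Finset.mem_filter.1 hj).2
      exact_mod_cast (by omega : b - w ≤ j - w)
    -- Before the insertion, the gap in front of the successor `b` passes over `w`.
    have hpredb : predGap A b = predGap A w + ((b - w : ℕ) : ℕ∞) := by
      have hf : A.filter (fun j => j < b) = A.filter (fun j => j < w) := by
        ext j
        simp only [Finset.mem_filter, and_congr_right_iff]
        intro hj
        refine ⟨fun hjb => ?_, fun hjw => hjw.trans hwb⟩
        by_contra hjw
        rcases eq_or_lt_of_le (not_lt.1 hjw) with rfl | hlt
        · exact hw hj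
        · exact absurd (hmin j hj hlt) (not_le.2 hjb)
      simp only [predGap, hf]
      by_cases h0 : (A.filter (fun j => j < w)).Nonempty
      · obtain ⟨a, ha, hea⟩ := Finset.exists_mem_eq_inf _ h0 (fun j => ((w - j : ℕ) : ℕ∞))
        rw [hea]
        have haw := (Finset.mem_filter.1 ha).2
        refine le_antisymm ?_ (Finset.le_inf fun j hj => ?_)
        · refine (Finset.inf_le ha).trans ?_
          exact_mod_cast (by omega : b - a ≤ w - a + (b - w))
        · have h1 : ((w - a : ℕ) : ℕ∞) ≤ ((w - j : ℕ) : ℕ∞) := hea ▸ Finset.inf_le hj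
          have h2 : w - a ≤ w - j := by exact_mod_cast h1
          have hjw := (Finset.mem_filter.1 hj).2
          exact_mod_cast (by omega : w - a + (b - w) ≤ b - j)
      · rw [Finset.not_nonempty_iff_eq_empty.1 h0]; simp
    have hinsb : predGap (insert w A) b = ((b - w : ℕ) : ℕ∞) := by
      rw [predGap_insert, if_pos hwb, hpredb, min_eq_left]
      exact le_add_self
    -- Elements beyond `b` already have `b` as a closer predecessor than `w`.
    have hrest : ∏ i ∈ A.erase b, gapWeightTop H p c (predGap (insert w A) i) =
        ∏ i ∈ A.erase b, gapWeightTop H p c (predGap A i) := by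
      refine Finset.prod_congr rfl fun i hi => ?_
      obtain ⟨hib, hiA⟩ := Finset.mem_erase.1 hi
      rw [predGap_insert]
      split_ifs with hwi
      · have hbi := lt_of_le_of_ne (hmin i hiA hwi) (Ne.symm hib)
        rw [min_eq_right]
        refine (predGap_le hbA hbi).trans ?_
        exact_mod_cast (by omega : i - b ≤ i - w)
      · rfl
    rw [← Finset.mul_prod_erase A _ hbA, hrest,
      ← Finset.mul_prod_erase A (fun i => gapWeightTop H p c (predGap A i)) hbA, hinsb, hsucc,
      hpredb]
    have := (gapWeightTop_pos (H := H) hp hc (predGap A w + ((b - w : ℕ) : ℕ∞))).ne'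
    field_simp
  -- Without a successor, numerator and denominator of the ratio share the weight `p` of an infinite
  -- gap.
  · have hsucc : succGap A w = ⊤ := by
      rw [succGap, Finset.not_nonempty_iff_eq_empty.1 h]; rfl
    rw [hsucc, add_top, gapWeightTop_top, mul_div_assoc, div_self hp.ne', mul_one]
    congr 1
    refine Finset.prod_congr rfl fun i hi => ?_
    rw [predGap_insert, if_neg]
    exact fun hwi => h ⟨i, Finset.mem_filter.2 ⟨hi, hwi⟩⟩

/-- The element `v` shields `w` from `z`. -/
lemma insertRatio_congr {A : Finset ℕ} {z v w : ℕ} (hv : v ∈ A) (hzv : z < v) (hvw : v < w) :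
    insertRatio H p c (insert z A) w = insertRatio H p c A w := by
  have h1 : predGap (insert z A) w = predGap A w := by
    rw [predGap_insert, if_pos (hzv.trans hvw), min_eq_right]
    refine (predGap_le hv hvw).trans ?_
    exact_mod_cast (by omega : w - v ≤ w - z)
  have h2 : succGap (insert z A) w = succGap A w := by
    rw [succGap, Finset.filter_insert, if_neg (by omega)]; rfl
  rw [insertRatio, h1, h2, insertRatio]

/-- This is log-convexity after clearing denominators: a closer neighbour raises the ratio. -/
lemma gapRatio_le (hH : H < 1) (hp : 0 < p) (hc : 0 < c) {x x' : ℕ∞} (y : ℕ∞)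
    (hx : 1 ≤ x) (hxx : x ≤ x') :
    gapWeightTop H p c x' * gapWeightTop H p c y / gapWeightTop H p c (x' + y) ≤
      gapWeightTop H p c x * gapWeightTop H p c y / gapWeightTop H p c (x + y) := by
  rw [div_le_div_iff₀ (gapWeightTop_pos hp hc _) (gapWeightTop_pos hp hc _)]
  have h1 := gapWeightTop_logConvex (p := p) hH hp hc (y := y) hx hxx
  have h2 := mul_le_mul_of_nonneg_left h1 (gapWeightTop_pos (H := H) hp hc y).le
  linarith

lemma insertRatio_le_insert (hH : H < 1) (hp : 0 < p) (hc : 0 < c) {A : Finset ℕ} {z w : ℕ}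
    (hzw : z < w) : insertRatio H p c A w ≤ insertRatio H p c (insert z A) w := by
  have h2 : succGap (insert z A) w = succGap A w := by
    rw [succGap, Finset.filter_insert, if_neg (by omega)]; rfl
  rw [insertRatio, insertRatio, h2]
  refine gapRatio_le hH hp hc _ (one_le_predGap _ _) ?_
  rw [predGap_insert, if_pos hzw]
  exact min_le_right _ _

/-- The extreme case has both neighbours at distance 1; `gapRatio_le` is applied once on each side.
-/
lemma insertRatio_le (hH : H < 1) (hp : 0 < p) (hc : 0 < c) (A : Finset ℕ) (w : ℕ) :
    insertRatio H p c A w ≤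
      gapWeight H p c 0 1 * gapWeight H p c 1 2 / gapWeight H p c 0 2 := by
  rw [gapWeight_eq_gapWeightTop (by norm_num), gapWeight_eq_gapWeightTop (by norm_num),
    gapWeight_eq_gapWeightTop (by norm_num), insertRatio]
  refine (gapRatio_le hH hp hc _ le_rfl (one_le_predGap A w)).trans ?_
  have h := gapRatio_le (H := H) (p := p) hH hp hc 1 le_rfl (one_le_succGap A w)
  rw [mul_comm, add_comm]
  exact h

end InsertRatio

/-! ### Signed inclusion-exclusion masses -/

/-- The family obtained from `A` by assigning the time `z` to the state `k`. -/
def addTime {m : ℕ} (A : Fin m → Finset ℕ) (k : Fin m) (z : ℕ) : Fin m → Finset ℕ :=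
  Function.update A k (insert z (A k))

/-- The inclusion-exclusion sum for the event that the times of each `A k` are in state `k` while,
for each `(z, K)` in the list, the time `z` is in no state of `K`. -/
noncomputable def signedMass {m : ℕ} (H p c : Fin m → ℝ) :
    List (ℕ × Finset (Fin m)) → (Fin m → Finset ℕ) → ℝ
  | [], A => LStarVec H p c A
  | (z, K) :: L, A => signedMass H p c L A - ∑ k ∈ K, signedMass H p c L (addTime A k z)

/-- The list of constraints saying that all times of `Z` are in the state `0`. -/
def fullConstraints (m : ℕ) (Z : List ℕ) : List (ℕ × Finset (Fin m)) :=
  Z.map fun z => (z, Finset.univ)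

section SignedMass

variable {m : ℕ} {H p c : Fin m → ℝ}

lemma addTime_apply_self (A : Fin m → Finset ℕ) (k : Fin m) (z : ℕ) :
    addTime A k z k = insert z (A k) := Function.update_self ..

lemma addTime_apply_of_ne (A : Fin m → Finset ℕ) {k l : Fin m} (h : l ≠ k) (z : ℕ) :
    addTime A k z l = A l := Function.update_of_ne h ..

lemma mem_addTime {A : Fin m → Finset ℕ} {k l : Fin m} {z i : ℕ} :
    i ∈ addTime A k z l ↔ (l = k ∧ i = z) ∨ i ∈ A l := by
  by_cases h : l = k
  · subst h; simp [addTime_apply_self]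
  · simp [addTime_apply_of_ne A h, h]

lemma addTime_comm (A : Fin m → Finset ℕ) (k l : Fin m) (z w : ℕ) :
    addTime (addTime A k z) l w = addTime (addTime A l w) k z := by
  ext i j
  simp only [mem_addTime]
  tauto

lemma subset_addTime (A : Fin m → Finset ℕ) (k l : Fin m) (z : ℕ) : A l ⊆ addTime A k z l :=
  fun _ hi => mem_addTime.2 (Or.inr hi)

lemma LStarVec_pos (hp : ∀ k, 0 < p k) (hc : ∀ k, 0 < c k) (A : Fin m → Finset ℕ) :
    0 < LStarVec H p c A :=
  Finset.prod_pos fun k _ => LStar_pos (hp k) (hc k) (A k)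

lemma LStarVec_addTime (hp : ∀ k, 0 < p k) (hc : ∀ k, 0 < c k) {A : Fin m → Finset ℕ}
    {k : Fin m} {w : ℕ} (hw : w ∉ A k) :
    LStarVec H p c (addTime A k w) =
      insertRatio (H k) (p k) (c k) (A k) w * LStarVec H p c A := by
  rw [LStarVec, LStarVec, ← Finset.mul_prod_erase _ _ (Finset.mem_univ k),
    ← Finset.mul_prod_erase _ (fun l => LStar (H l) (p l) (c l) (A l)) (Finset.mem_univ k),
    addTime_apply_self, LStar_insert (hp k) (hc k) hw, mul_assoc]
  congr 2
  exact Finset.prod_congr rfl fun l hl => by rw [addTime_apply_of_ne A (Finset.ne_of_mem_erase hl)]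

/-- Exchanging two constraints exchanges two finite sums. This allows sorting the zeros and moving
any chosen constraint to the front. -/
lemma signedMass_perm {L L' : List (ℕ × Finset (Fin m))} (h : L.Perm L') :
    ∀ A, signedMass H p c L A = signedMass H p c L' A := by
  induction h with
  | nil => exact fun _ => rfl
  | cons x _ ih => exact fun A => by simp only [signedMass, ih]
  | swap x y L =>
    intro A
    simp only [signedMass, Finset.sum_sub_distrib]
    rw [Finset.sum_comm]
    simp only [addTime_comm A]
    ring
  | trans _ _ ih₁ ih₂ => exact fun A => (ih₁ A).trans (ih₂ A)

/-- Adding `w` to a state `k` multiplies the mass by the insertion ratio, provided that no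
constraint involving `k` can change the neighbours of `w`. -/
lemma signedMass_addTime (hp : ∀ k, 0 < p k) (hc : ∀ k, 0 < c k) {k : Fin m} {w : ℕ}
    {L : List (ℕ × Finset (Fin m))} :
    ∀ {A : Fin m → Finset ℕ}, w ∉ A k →
      (∀ x ∈ L, k ∈ x.2 → ∃ v ∈ A k, x.1 < v ∧ v < w) →
      signedMass H p c L (addTime A k w) =
        insertRatio (H k) (p k) (c k) (A k) w * signedMass H p c L A := by
  induction L with
  | nil => exact fun hw _ => LStarVec_addTime hp hc hw
  | cons x L ih =>
    obtain ⟨z, K⟩ := x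
    intro A hw hL
    have hL' : ∀ x ∈ L, k ∈ x.2 → ∃ v ∈ A k, x.1 < v ∧ v < w :=
      fun x hx => hL x (List.mem_cons_of_mem _ hx)
    simp only [signedMass]
    rw [ih hw hL', mul_sub, Finset.mul_sum]
    congr 1
    refine Finset.sum_congr rfl fun l hl => ?_
    rw [addTime_comm, ih]
    -- If `z` enters the same state `k`, the element `v` between `z` and `w` keeps the ratio
    -- unchanged.
    · by_cases hlk : l = k
      · subst hlk
        obtain ⟨v, hv, hzv, hvw⟩ := hL (z, K) List.mem_cons_self hl
        rw [addTime_apply_self, insertRatio_congr hv hzv hvw]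
      · rw [addTime_apply_of_ne A (Ne.symm hlk)]
    · rw [mem_addTime]
      rintro (⟨rfl, rfl⟩ | h)
      · obtain ⟨v, _, h1, h2⟩ := hL (w, K) List.mem_cons_self hl
        exact absurd (h1.trans h2) (lt_irrefl _)
      · exact hw h
    · intro x hx hkx
      obtain ⟨v, hv, h⟩ := hL' x hx hkx
      exact ⟨v, subset_addTime _ _ _ _ hv, h⟩

/-- The times of the constraints in `L` are distinct and not used by `A`. -/
def FreshTimes (L : List (ℕ × Finset (Fin m))) (A : Fin m → Finset ℕ) : Prop :=
  (L.map Prod.fst).Nodup ∧ ∀ x ∈ L, ∀ k, x.1 ∉ A k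

lemma FreshTimes.perm {L L' : List (ℕ × Finset (Fin m))} {A : Fin m → Finset ℕ}
    (h : FreshTimes L A) (hL : L.Perm L') : FreshTimes L' A :=
  ⟨(hL.map _).nodup_iff.1 h.1, fun x hx => h.2 x (hL.mem_iff.2 hx)⟩

lemma FreshTimes.tail {x : ℕ × Finset (Fin m)} {L : List (ℕ × Finset (Fin m))}
    {A : Fin m → Finset ℕ} (h : FreshTimes (x :: L) A) : FreshTimes L A :=
  ⟨(List.nodup_cons.1 h.1).2, fun y hy => h.2 y (List.mem_cons_of_mem _ hy)⟩

lemma FreshTimes.addTime {z : ℕ} {K : Finset (Fin m)} {L : List (ℕ × Finset (Fin m))}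
    {A : Fin m → Finset ℕ} (h : FreshTimes ((z, K) :: L) A) (k : Fin m) :
    FreshTimes L (addTime A k z) := by
  refine ⟨h.tail.1, fun x hx l hl => ?_⟩
  rcases mem_addTime.1 hl with ⟨_, hxz⟩ | h'
  · have hmem := List.mem_map_of_mem (f := Prod.fst) hx
    rw [hxz] at hmem
    exact (List.nodup_cons.1 h.1).1 hmem
  · exact h.2 x (List.mem_cons_of_mem _ hx) l h'

lemma FreshTimes.cons_congr {z : ℕ} {K K' : Finset (Fin m)} {L : List (ℕ × Finset (Fin m))}
    {A : Fin m → Finset ℕ} (h : FreshTimes ((z, K) :: L) A) : FreshTimes ((z, K') :: L) A := by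
  refine ⟨h.1, fun x hx => ?_⟩
  rcases List.mem_cons.1 hx with rfl | hx
  · exact h.2 (z, K) List.mem_cons_self
  · exact h.2 x (List.mem_cons_of_mem _ hx)

/-- Earlier zeros can only decrease the conditional probability of finding `w` in the state `k`. -/
lemma signedMass_addTime_le (hH : ∀ k, H k < 1) (hp : ∀ k, 0 < p k) (hc : ∀ k, 0 < c k)
    {k : Fin m} {w : ℕ} {A : Fin m → Finset ℕ} (hw : w ∉ A k) {Z : List ℕ} :
    ∀ {P : List (ℕ × Finset (Fin m))}, Z.Pairwise (· > ·) → (∀ z ∈ Z, z < w) →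
      (∀ x ∈ P, k ∉ x.2) → FreshTimes (fullConstraints m Z ++ P) A →
      (∀ L B, L.length < (fullConstraints m Z ++ P).length → FreshTimes L B →
        0 ≤ signedMass H p c L B) →
      signedMass H p c (fullConstraints m Z ++ P) (addTime A k w) ≤
        insertRatio (H k) (p k) (c k) (A k) w *
          signedMass H p c (fullConstraints m Z ++ P) A := by
  induction Z with
  | nil =>
    intro P _ _ hP _ _
    exact (signedMass_addTime hp hc hw fun x hx hk => absurd hk (hP x hx)).le
  | cons z Z ih =>
    intro P hZ hzw hP hfresh hpos
    obtain ⟨hz, hZ'⟩ := List.pairwise_cons.1 hZ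
    set R := fullConstraints m Z ++ P with hR
    have hcons : fullConstraints m (z :: Z) ++ P = (z, Finset.univ) :: R := rfl
    rw [hcons] at hfresh hpos ⊢
    have hperm : ((z, Finset.univ.erase k) :: R).Perm
        (fullConstraints m Z ++ (z, Finset.univ.erase k) :: P) := List.perm_middle.symm
    -- The state `k` is taken out of the constraint at `z`; the weakened constraint joins `P`, and
    -- the correction puts `z` into state `k`.
    have hsplit : ∀ B, signedMass H p c ((z, Finset.univ) :: R) B =
        signedMass H p c (fullConstraints m Z ++ (z, Finset.univ.erase k) :: P) B -
          signedMass H p c R (addTime B k z) := by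
      intro B
      rw [← signedMass_perm hperm]
      simp only [signedMass]
      rw [← Finset.add_sum_erase _ _ (Finset.mem_univ k)]
      ring
    have h1 := ih (P := (z, Finset.univ.erase k) :: P) hZ'
      (fun y hy => hzw y (List.mem_cons_of_mem _ hy))
      (fun x hx => by
        rcases List.mem_cons.1 hx with rfl | hx
        · simp
        · exact hP x hx)
      (hfresh.cons_congr.perm hperm)
      (fun L B hL hB => hpos L B (by rw [← hperm.length_eq] at hL; simpa using hL) hB)
    have hzw' : z < w := hzw z List.mem_cons_self
    -- Here the factor is exact: the zeros remaining in `Z` lie before `z`, which now belongs to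
    -- state `k`, and `P` does not involve `k`.
    have h2 : signedMass H p c R (addTime (addTime A k w) k z) =
        insertRatio (H k) (p k) (c k) (insert z (A k)) w *
          signedMass H p c R (addTime A k z) := by
      rw [addTime_comm, signedMass_addTime hp hc, addTime_apply_self]
      · rw [addTime_apply_self, Finset.mem_insert, not_or]
        exact ⟨hzw'.ne', hw⟩
      · intro x hx hk
        refine ⟨z, by simp [addTime_apply_self], ?_, hzw'⟩
        rcases List.mem_append.1 hx with hx | hx
        · obtain ⟨y, hy, rfl⟩ := List.mem_map.1 hx
          exact hz y hy
        · exact absurd hk (hP x hx)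
    have h3 : 0 ≤ signedMass H p c R (addTime A k z) :=
      hpos _ _ (by simp) (hfresh.addTime k)
    have h4 := mul_le_mul_of_nonneg_right
      (insertRatio_le_insert (hH k) (hp k) (hc k) (A := A k) hzw') h3
    rw [hsplit, hsplit, h2, mul_sub]
    linarith

/-- Removing the latest zero `w` leaves a mass of which the states at `w` take at most the fractions
`insertRatio`, and these sum to at most 1. -/
lemma signedMass_full_nonneg (hH : ∀ k, H k < 1) (hp : ∀ k, 0 < p k) (hc : ∀ k, 0 < c k)
    (hb : ∀ (A : Fin m → Finset ℕ) (w : ℕ),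
      ∑ k, insertRatio (H k) (p k) (c k) (A k) w ≤ 1)
    {Z : List ℕ} {A : Fin m → Finset ℕ} (hfresh : FreshTimes (fullConstraints m Z) A)
    (hpos : ∀ L B, L.length < Z.length → FreshTimes L B → 0 ≤ signedMass H p c L B) :
    0 ≤ signedMass H p c (fullConstraints m Z) A := by
  -- Decreasing order puts the latest zero at the head, so that all others precede it.
  set S := Z.mergeSort (fun a b => decide (b ≤ a)) with hS
  have hperm : Z.Perm S := (List.mergeSort_perm _ _).symm
  have hnodup : S.Nodup := by
    have h := hfresh.1
    rw [fullConstraints, List.map_map] at h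
    exact hperm.nodup_iff.1 (by simpa [Function.comp_def] using h)
  have hsort : S.Pairwise (· > ·) := by
    have h1 : S.Pairwise (fun a b => decide (b ≤ a) = true) :=
      List.pairwise_mergeSort (fun a b c h1 h2 => by simp at *; omega)
        (fun a b => by simp; omega) Z
    exact (h1.and hnodup).imp fun h => by
      have := h.1; have := h.2; simp at *; omega
  have hfp : (fullConstraints m Z).Perm (fullConstraints m S) := hperm.map _
  rw [signedMass_perm hfp]
  replace hfresh := hfresh.perm hfp
  rw [hperm.length_eq] at hpos
  clear_value S
  cases S with
  | nil => exact (LStarVec_pos hp hc A).le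
  | cons w S =>
    obtain ⟨hw, hS'⟩ := List.pairwise_cons.1 hsort
    have h0 : 0 ≤ signedMass H p c (fullConstraints m S) A :=
      hpos _ _ (by simp [fullConstraints]) hfresh.tail
    have h1 : ∀ k, signedMass H p c (fullConstraints m S) (addTime A k w) ≤
        insertRatio (H k) (p k) (c k) (A k) w * signedMass H p c (fullConstraints m S) A := by
      intro k
      have := signedMass_addTime_le hH hp hc (k := k) (w := w) (A := A)
        (hfresh.2 (w, Finset.univ) List.mem_cons_self k) (P := []) hS' hw (by simp)
        (by rw [List.append_nil]; exact hfresh.tail)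
        (fun L B hL hB => hpos L B (by simp [fullConstraints] at hL ⊢; omega) hB)
      simpa using this
    have h2 := Finset.sum_le_sum fun k (_ : k ∈ Finset.univ) => h1 k
    rw [← Finset.sum_mul] at h2
    have h3 := mul_le_mul_of_nonneg_right (hb A w) h0
    change 0 ≤ signedMass H p c (fullConstraints m S) A -
      ∑ k, signedMass H p c (fullConstraints m S) (addTime A k w)
    linarith

/-- Strong induction on the number of constraints. Enlarging a constraint to all states only
subtracts masses with fewer constraints, which reduces the claim to full constraints. -/
lemma signedMass_nonneg (hH : ∀ k, H k < 1) (hp : ∀ k, 0 < p k) (hc : ∀ k, 0 < c k)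
    (hb : ∀ (A : Fin m → Finset ℕ) (w : ℕ),
      ∑ k, insertRatio (H k) (p k) (c k) (A k) w ≤ 1) (n : ℕ) :
    ∀ L A, L.length = n → FreshTimes L A → 0 ≤ signedMass H p c L A := by
  induction n using Nat.strong_induction_on with
  | _ n ih =>
    -- `L₁` holds the constraints still to be enlarged, `Z` the times already carrying a full one.
    have key : ∀ (L₁ : List (ℕ × Finset (Fin m))) (Z : List ℕ) (A : Fin m → Finset ℕ),
        L₁.length + Z.length = n → FreshTimes (L₁ ++ fullConstraints m Z) A →
        0 ≤ signedMass H p c (L₁ ++ fullConstraints m Z) A := by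
      intro L₁
      induction L₁ with
      | nil =>
        intro Z A hn hfresh
        exact signedMass_full_nonneg hH hp hc hb hfresh
          fun L B hL hB => ih L.length (by simp at hn; omega) L B rfl hB
      | cons x L₁ ih₁ =>
        obtain ⟨z, K⟩ := x
        intro Z A hn hfresh
        rw [List.cons_append] at hfresh ⊢
        have hperm : ((z, Finset.univ) :: (L₁ ++ fullConstraints m Z)).Perm
            (L₁ ++ fullConstraints m (z :: Z)) := List.perm_middle.symm
        have h1 := ih₁ (z :: Z) A (by simp at hn ⊢; omega) (hfresh.cons_congr.perm hperm)
        rw [← signedMass_perm hperm] at h1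
        have h2 : ∀ k, 0 ≤ signedMass H p c (L₁ ++ fullConstraints m Z) (addTime A k z) :=
          fun k => ih (L₁.length + Z.length) (by simp at hn; omega) _ _
            (by simp [fullConstraints]) (hfresh.addTime k)
        have h3 := Finset.sum_le_sum_of_subset_of_nonneg (Finset.subset_univ K)
          fun k _ _ => h2 k
        simp only [signedMass] at h1 ⊢
        linarith
    intro L A hL hfresh
    have := key L [] A (by simpa using hL) (by simpa [fullConstraints] using hfresh)
    simpa [fullConstraints] using this

end SignedMass

/-! ### Recursion for the inclusion-exclusion sum -/

section Recursion

variable {m : ℕ} {H p c : Fin m → ℝ}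

lemma mem_splittings {B : Finset ℕ} {F : Fin m → Finset ℕ} :
    F ∈ splittings m B ↔
      (∀ k l, k ≠ l → Disjoint (F k) (F l)) ∧ Finset.univ.biUnion F = B := by
  rw [splittings, Finset.mem_filter, Fintype.mem_piFinset, and_iff_right_iff_imp]
  rintro ⟨_, rfl⟩ k
  exact Finset.mem_powerset.2 (Finset.subset_biUnion_of_mem F (Finset.mem_univ k))

lemma not_mem_of_mem_splittings {B : Finset ℕ} {F : Fin m → Finset ℕ} (hF : F ∈ splittings m B)
    {z : ℕ} (hz : z ∉ B) (k : Fin m) : z ∉ F k := by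
  intro h
  rw [← (mem_splittings.1 hF).2] at hz
  exact hz (Finset.mem_biUnion.2 ⟨k, Finset.mem_univ k, h⟩)

/-- A splitting of the larger set is a splitting of `B` together with a choice of the state that
receives `z`. -/
lemma sum_splittings_insert {B : Finset ℕ} {z : ℕ} (hz : z ∉ B)
    (φ : (Fin m → Finset ℕ) → ℝ) :
    ∑ F ∈ splittings m (insert z B), φ F =
      ∑ k, ∑ F ∈ splittings m B, φ (addTime F k z) := by
  rw [← Finset.sum_product']
  symm
  refine Finset.sum_nbij (fun q => addTime q.2 q.1 z) ?_ ?_ ?_ fun _ _ => rfl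
  · rintro ⟨k, F⟩ hq
    have hF := (Finset.mem_product.1 hq).2
    have hzF := not_mem_of_mem_splittings hF hz
    obtain ⟨hd, hu⟩ := mem_splittings.1 hF
    refine mem_splittings.2 ⟨fun a b hab => ?_, ?_⟩
    · rw [Finset.disjoint_left]
      intro i hi hj
      rcases mem_addTime.1 hi with ⟨ha, h1⟩ | h1 <;> rcases mem_addTime.1 hj with ⟨hb, h2⟩ | h2
      · exact hab (ha.trans hb.symm)
      · exact hzF b (h1 ▸ h2)
      · exact hzF a (h2 ▸ h1)
      · exact Finset.disjoint_left.1 (hd a b hab) h1 h2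
    · ext i
      rw [← hu]
      simp only [Finset.mem_biUnion, Finset.mem_univ, true_and, mem_addTime, Finset.mem_insert]
      constructor
      · rintro ⟨a, ⟨_, h⟩ | h⟩
        · exact Or.inl h
        · exact Or.inr ⟨a, h⟩
      · rintro (h | ⟨a, h⟩)
        · exact ⟨k, Or.inl ⟨rfl, h⟩⟩
        · exact ⟨a, Or.inr h⟩
  · rintro ⟨k, F⟩ hq ⟨k', F'⟩ hq' heq
    have hzF := not_mem_of_mem_splittings (Finset.mem_product.1 hq).2 hz
    have hzF' := not_mem_of_mem_splittings (Finset.mem_product.1 hq').2 hz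
    dsimp only at heq hzF hzF'
    have hk : k = k' := by
      have h : z ∈ addTime F k z k := mem_addTime.2 (Or.inl ⟨rfl, rfl⟩)
      rw [heq] at h
      rcases mem_addTime.1 h with ⟨h, _⟩ | h
      · exact h
      · exact absurd h (hzF' k)
    subst hk
    congr 1
    ext l i
    have h : i ∈ addTime F k z l ↔ i ∈ addTime F' k z l := by rw [heq]
    simp only [mem_addTime] at h
    by_cases hi : i = z
    · subst hi; simp [hzF, hzF']
    · simpa [hi] using h
  · intro G hG
    obtain ⟨hd, hu⟩ := mem_splittings.1 (Finset.mem_coe.1 hG)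
    obtain ⟨k, _, hk⟩ := Finset.mem_biUnion.1 (hu ▸ Finset.mem_insert_self z B)
    have hnot : ∀ l, l ≠ k → z ∉ G l := fun l hl h =>
      Finset.disjoint_left.1 (hd l k hl) h hk
    refine ⟨(k, fun l => (G l).erase z), ?_, ?_⟩
    · refine Finset.mem_coe.2 (Finset.mem_product.2 ⟨Finset.mem_univ _, mem_splittings.2
        ⟨fun a b hab => (hd a b hab).mono (Finset.erase_subset _ _) (Finset.erase_subset _ _),
          ?_⟩⟩)
      ext i
      have hui : i ∈ Finset.univ.biUnion G ↔ i ∈ insert z B := by rw [hu]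
      simp only [Finset.mem_biUnion, Finset.mem_univ, true_and, Finset.mem_insert,
        Finset.mem_erase] at hui ⊢
      by_cases hi : i = z
      · subst hi; simp [hz]
      · simpa [hi] using hui
    · funext l
      ext i
      simp only [mem_addTime, Finset.mem_erase]
      by_cases hi : i = z
      · subst hi
        by_cases hl : l = k
        · subst hl; simp [hk]
        · simp [hl, hnot l hl]
      · simp [hi]

lemma DStar_eq_sum_powerset (A : Fin m → Finset ℕ) (Z : Finset ℕ) :
    DStar H p c A Z = ∑ B ∈ Z.powerset, (-1 : ℝ) ^ B.card *
      ∑ F ∈ splittings m B, LStarVec H p c (fun k => A k ∪ F k) := by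
  rw [Finset.sum_powerset, DStar]
  refine Finset.sum_congr rfl fun l _ => ?_
  rw [Finset.mul_sum]
  exact Finset.sum_congr rfl fun B hB => by rw [(Finset.mem_powersetCard.1 hB).2]

lemma DStar_empty (A : Fin m → Finset ℕ) : DStar H p c A ∅ = LStarVec H p c A := by
  have h : splittings m ∅ = {fun _ => ∅} := by
    ext F
    rw [mem_splittings, Finset.mem_singleton]
    refine ⟨fun h => ?_, ?_⟩
    · funext k
      exact Finset.subset_empty.1 (h.2 ▸ Finset.subset_biUnion_of_mem F (Finset.mem_univ k))
    · rintro rfl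
      refine ⟨by simp, ?_⟩
      ext; simp
  rw [DStar_eq_sum_powerset, Finset.powerset_empty, Finset.sum_singleton, h]
  simp

/-- Subsets of the enlarged set either avoid `z` or contain it; the latter carry an extra sign and a
choice of state for `z`. Probabilities satisfy the same recursion by `measureReal_inter_zero`. -/
lemma DStar_insert (A : Fin m → Finset ℕ) {Z : Finset ℕ} {z : ℕ} (hz : z ∉ Z) :
    DStar H p c A (insert z Z) =
      DStar H p c A Z - ∑ k, DStar H p c (addTime A k z) Z := by
  have key : ∀ B ∈ Z.powerset,
      (-1 : ℝ) ^ (insert z B).card *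
        ∑ F ∈ splittings m (insert z B), LStarVec H p c (fun k => A k ∪ F k) =
      -∑ k, (-1 : ℝ) ^ B.card *
        ∑ F ∈ splittings m B, LStarVec H p c (fun l => addTime A k z l ∪ F l) := by
    intro B hB
    have hzB : z ∉ B := fun h => hz (Finset.mem_powerset.1 hB h)
    rw [Finset.card_insert_of_notMem hzB, sum_splittings_insert hzB, pow_succ, mul_neg_one,
      neg_mul, Finset.mul_sum]
    refine congrArg Neg.neg (Finset.sum_congr rfl fun k _ => ?_)
    refine congrArg (_ * ·) (Finset.sum_congr rfl fun F _ => ?_)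
    refine congrArg (LStarVec H p c) (funext fun l => ?_)
    ext i
    simp only [Finset.mem_union, mem_addTime]
    tauto
  rw [DStar_eq_sum_powerset, Finset.sum_powerset_insert hz, Finset.sum_congr rfl key,
    Finset.sum_neg_distrib, Finset.sum_comm, ← sub_eq_add_neg, DStar_eq_sum_powerset]
  refine congrArg (_ - ·) (Finset.sum_congr rfl fun k _ => ?_)
  rw [DStar_eq_sum_powerset]

end Recursion

/-! ### The probability of a cylinder -/

section Cylinder

variable {m : ℕ}

/-- The event that every time of `A k` is in the state `k + 1`. -/
def stateEvent {Ω : Type*} (X : ℕ → Ω → Fin (m + 1)) (A : Fin m → Finset ℕ) : Set Ω :=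
  {ω | ∀ k, ∀ i ∈ A k, X i ω = k.succ}

lemma measurableSet_stateEvent {Ω : Type*} [MeasurableSpace Ω] {X : ℕ → Ω → Fin (m + 1)}
    (hX : ∀ i, Measurable (X i)) (A : Fin m → Finset ℕ) : MeasurableSet (stateEvent X A) := by
  simp only [stateEvent, Set.ofPred_forall]
  exact MeasurableSet.iInter fun k => MeasurableSet.iInter fun i => MeasurableSet.iInter fun _ =>
    hX i (measurableSet_singleton _)

lemma stateEvent_addTime {Ω : Type*} (X : ℕ → Ω → Fin (m + 1)) (A : Fin m → Finset ℕ)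
    (k : Fin m) (z : ℕ) :
    stateEvent X (addTime A k z) = stateEvent X A ∩ {ω | X z ω = k.succ} := by
  ext ω
  simp only [stateEvent, Set.mem_ofPred_eq, Set.mem_inter_iff, mem_addTime]
  constructor
  · exact fun h => ⟨fun l i hi => h l i (Or.inr hi), h k z (Or.inl ⟨rfl, rfl⟩)⟩
  · rintro ⟨h1, h2⟩ l i (⟨rfl, rfl⟩ | hi)
    · exact h2
    · exact h1 l i hi

lemma measureReal_inter_zero {Ω : Type*} [MeasurableSpace Ω] (P : Measure Ω)
    [IsFiniteMeasure P] {Y : Ω → Fin (m + 1)} (hY : Measurable Y) (E : Set Ω) :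
    P.real (E ∩ {ω | Y ω = 0}) = P.real E - ∑ k : Fin m, P.real (E ∩ {ω | Y ω = k.succ}) := by
  have h : ∑ a : Fin (m + 1), P.real (E ∩ {ω | Y ω = a}) = P.real E := by
    have h1 := sum_measureReal_preimage_singleton (μ := P.restrict E) (f := Y) Finset.univ
      (fun a _ => hY (measurableSet_singleton a))
    simp only [Finset.coe_univ, Set.preimage_univ] at h1
    rw [measureReal_restrict_apply MeasurableSet.univ, Set.univ_inter] at h1
    rw [← h1]
    refine Finset.sum_congr rfl fun a _ => ?_
    rw [measureReal_restrict_apply (hY (measurableSet_singleton a)), Set.inter_comm]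
    rfl
  rw [← h, Fin.sum_univ_succ]
  ring

/-- The joint law follows from the probabilities of the events without the state `0`. -/
lemma joint_of_positive {H p c : Fin m → ℝ} {Ω : Type*} [MeasurableSpace Ω] {P : Measure Ω}
    [IsFiniteMeasure P] {X : ℕ → Ω → Fin (m + 1)} (hX : ∀ i, Measurable (X i))
    (hpos : ∀ A : Fin m → Finset ℕ, (∀ k l, k ≠ l → Disjoint (A k) (A l)) →
      P.real (stateEvent X A) = LStarVec H p c A) (Z : Finset ℕ) :
    ∀ A : Fin m → Finset ℕ, (∀ k, Disjoint Z (A k)) →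
      (∀ k l, k ≠ l → Disjoint (A k) (A l)) →
      P.real {ω | (∀ i ∈ Z, X i ω = 0) ∧ ∀ k, ∀ i ∈ A k, X i ω = k.succ} =
        DStar H p c A Z := by
  induction Z using Finset.induction_on with
  | empty =>
    intro A _ hA
    rw [DStar_empty, ← hpos A hA]
    simp [stateEvent]
  | insert z Z hz ih =>
    intro A hZA hA
    have hzA : ∀ k, z ∉ A k := fun k =>
      Finset.disjoint_left.1 (hZA k) (Finset.mem_insert_self z Z)
    have hZA' : ∀ k, Disjoint Z (A k) := fun k =>
      (hZA k).mono_left (Finset.subset_insert z Z)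
    set E : Set Ω := {ω | (∀ i ∈ Z, X i ω = 0) ∧ ∀ k, ∀ i ∈ A k, X i ω = k.succ} with hE
    have h1 : {ω | (∀ i ∈ insert z Z, X i ω = 0) ∧ ∀ k, ∀ i ∈ A k, X i ω = k.succ} =
        E ∩ {ω | X z ω = 0} := by
      ext ω
      simp only [hE, Finset.mem_insert, forall_eq_or_imp, Set.mem_ofPred_eq, Set.mem_inter_iff]
      tauto
    rw [h1, measureReal_inter_zero P (hX z), DStar_insert A hz, ← ih A hZA' hA]
    congr 1
    refine Finset.sum_congr rfl fun k _ => ?_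
    rw [← ih (addTime A k z)]
    · congr 1
      have h2 := stateEvent_addTime X A k z
      ext ω
      have h3 := Set.ext_iff.1 h2 ω
      simp only [stateEvent, Set.mem_ofPred_eq, Set.mem_inter_iff] at h3
      simp only [hE, Set.mem_ofPred_eq, Set.mem_inter_iff, h3]
      tauto
    · intro l
      rw [Finset.disjoint_left]
      intro i hi hil
      rcases mem_addTime.1 hil with ⟨_, rfl⟩ | h
      · exact hz hi
      · exact Finset.disjoint_left.1 (hZA' l) hi h
    · intro a b hab
      rw [Finset.disjoint_left]
      intro i hi hj
      rcases mem_addTime.1 hi with ⟨ha, h1⟩ | h1 <;> rcases mem_addTime.1 hj with ⟨hb, h2⟩ | h2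
      · exact hab (ha.trans hb.symm)
      · exact hzA b (h1 ▸ h2)
      · exact hzA a (h2 ▸ h1)
      · exact Finset.disjoint_left.1 (hA a b hab) h1 h2

end Cylinder

/-! ### Existence of the process -/

section Existence

variable {m : ℕ} {H p c : Fin m → ℝ}

/-- Nonnegative masses give a finite measure on sequences with prescribed cylinder masses. -/
lemma exists_measure_stateEvent
    (hpos : ∀ (Z : List ℕ) (A : Fin m → Finset ℕ), FreshTimes (fullConstraints m Z) A →
      0 ≤ signedMass H p c (fullConstraints m Z) A) (n : ℕ) :
    ∀ (Z : List ℕ) (A : Fin m → Finset ℕ), FreshTimes (fullConstraints m Z) A →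
      (∀ z ∈ Z, n ≤ z) → (∀ k, ∀ i ∈ A k, n ≤ i) →
      ∃ ν : Measure (ℕ → Fin (m + 1)), IsFiniteMeasure ν ∧
        ∀ C : Fin m → Finset ℕ, (∀ k l, k ≠ l → Disjoint (C k) (C l)) →
          (∀ k, ∀ i ∈ C k, i < n) →
          ν.real (stateEvent (fun i x => x i) C) =
            signedMass H p c (fullConstraints m Z) (fun k => A k ∪ C k) := by
  induction n with
  | zero =>
    intro Z A hfresh _ _
    -- No time lies below 0, so only the total mass is prescribed and the support point is
    -- arbitrary. Nonnegativity of the mass is used here.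
    refine ⟨ENNReal.ofReal (signedMass H p c (fullConstraints m Z) A) •
      Measure.dirac (fun _ => 0), ⟨by simp⟩, fun C _ hC => ?_⟩
    have hC0 : ∀ k, C k = ∅ := fun k =>
      Finset.eq_empty_of_forall_notMem fun i hi => absurd (hC k i hi) (Nat.not_lt_zero i)
    have hE : stateEvent (fun i (x : ℕ → Fin (m + 1)) => x i) C = Set.univ := by
      ext x; simp [stateEvent, hC0]
    rw [hE]
    simp [hC0, Measure.real, ENNReal.toReal_ofReal (hpos Z A hfresh)]
  | succ n ih =>
    intro Z A hfresh hZ hA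
    have hfresh0 : FreshTimes (fullConstraints m (n :: Z)) A := by
      refine ⟨?_, ?_⟩
      · have h := hfresh.1
        simp only [fullConstraints, List.map_map, List.map_cons] at h ⊢
        refine List.nodup_cons.2 ⟨fun hn => ?_, h⟩
        obtain ⟨z, hz, hzn⟩ := List.mem_map.1 hn
        have := hZ z hz
        simp at hzn
        omega
      · intro x hx k hk
        rcases List.mem_cons.1 hx with rfl | hx
        · have := hA k _ hk
          simp at this
        · exact hfresh.2 x hx k hk
    obtain ⟨ν₀, hν₀, h₀⟩ := ih (n :: Z) A hfresh0
      (by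
        intro z hz
        rcases List.mem_cons.1 hz with rfl | hz
        · exact le_rfl
        · exact (Nat.le_succ n).trans (hZ z hz))
      (fun k i hi => (Nat.le_succ n).trans (hA k i hi))
    have hk : ∀ k : Fin m, ∃ ν : Measure (ℕ → Fin (m + 1)), IsFiniteMeasure ν ∧
        ∀ C : Fin m → Finset ℕ, (∀ k l, k ≠ l → Disjoint (C k) (C l)) →
          (∀ k, ∀ i ∈ C k, i < n) →
          ν.real (stateEvent (fun i x => x i) C) =
            signedMass H p c (fullConstraints m Z) (fun l => addTime A k n l ∪ C l) := by
      intro k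
      refine ih Z (addTime A k n) (FreshTimes.addTime (K := Finset.univ) hfresh0 k)
        (fun z hz => (Nat.le_succ n).trans (hZ z hz)) fun l i hi => ?_
      rcases mem_addTime.1 hi with ⟨_, rfl⟩ | hi
      · exact le_rfl
      · exact (Nat.le_succ n).trans (hA l i hi)
    choose ν hν h using hk
    -- The measures for the possible states at time `n` are made to carry that state by overwriting
    -- coordinate `n`, and then added.
    let upd : Fin (m + 1) → (ℕ → Fin (m + 1)) → ℕ → Fin (m + 1) :=
      fun s x => Function.update x n s
    have hupd : ∀ s, Measurable (upd s) := by
      intro s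
      refine measurable_pi_lambda _ fun i => ?_
      by_cases hi : i = n
      · subst hi; simp [upd]
      · simpa [upd, hi] using measurable_pi_apply i
    refine ⟨ν₀.map (upd 0) + ∑ k, (ν k).map (upd k.succ), inferInstance, fun C hCd hC => ?_⟩
    set E : Set (ℕ → Fin (m + 1)) := stateEvent (fun i x => x i) C with hE
    have hEm : MeasurableSet E := measurableSet_stateEvent (fun i => measurable_pi_apply i) C
    have hreal : (ν₀.map (upd 0) + ∑ k, (ν k).map (upd k.succ)).real E =
        ν₀.real (upd 0 ⁻¹' E) + ∑ k : Fin m, (ν k).real (upd k.succ ⁻¹' E) := by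
      rw [measureReal_add_apply, map_measureReal_apply (hupd 0) hEm]
      congr 1
      rw [Measure.real, Measure.finsetSum_apply, ENNReal.toReal_sum fun k _ => measure_ne_top _ _]
      exact Finset.sum_congr rfl fun k _ => map_measureReal_apply (hupd _) hEm
    rw [hreal]
    by_cases hn : ∃ k, n ∈ C k
    · obtain ⟨k, hnk⟩ := hn
      -- When `C` prescribes the state at `n`, only one summand survives.
      have hempty : ∀ s, s ≠ k.succ → upd s ⁻¹' E = ∅ := by
        intro s hs
        refine Set.eq_empty_of_forall_notMem fun x hx => hs ?_
        have := hx k n hnk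
        simpa [upd] using this
      have hE' : upd k.succ ⁻¹' E =
          stateEvent (fun i x => x i) (fun l => (C l).erase n) := by
        ext x
        simp only [hE, stateEvent, Set.mem_preimage, Set.mem_ofPred_eq, Finset.mem_erase, upd]
        constructor
        · intro hx l i hi
          simpa [hi.1] using hx l i hi.2
        · intro hx l i hi
          by_cases hin : i = n
          · subst hin
            have hlk : l = k := by
              by_contra hlk
              exact Finset.disjoint_left.1 (hCd l k hlk) hi hnk
            simp [hlk]
          · simpa [hin] using hx l i ⟨hin, hi⟩
      rw [hempty 0 (Fin.succ_ne_zero k).symm, measureReal_empty, zero_add,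
        Finset.sum_eq_single k _ (by simp), hE', h k]
      · congr 1
        funext l
        ext i
        simp only [Finset.mem_union, mem_addTime, Finset.mem_erase]
        by_cases hin : i = n
        · subst hin
          by_cases hlk : l = k
          · subst hlk; simp [hnk]
          · have : i ∉ C l := fun hi => Finset.disjoint_left.1 (hCd l k hlk) hi hnk
            simp [hlk, this]
        · simp [hin]
      · exact fun a b hab =>
          (hCd a b hab).mono (Finset.erase_subset _ _) (Finset.erase_subset _ _)
      · intro l i hi
        have h1 := Finset.mem_erase.1 hi
        have := hC l i h1.2
        omega
      · intro l _ hl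
        rw [hempty _ (fun h => hl (Fin.succ_injective m h)), measureReal_empty]
    · push Not at hn
      have hC' : ∀ k, ∀ i ∈ C k, i < n := by
        intro k i hi
        have h1 := hC k i hi
        have h2 : i ≠ n := fun h => hn k (h ▸ hi)
        omega
      have hE' : ∀ s, upd s ⁻¹' E = E := by
        intro s
        ext x
        simp only [hE, stateEvent, Set.mem_preimage, Set.mem_ofPred_eq, upd]
        refine forall_congr' fun l => forall_congr' fun i => forall_congr' fun hi => ?_
        rw [Function.update_of_ne (hC' l i hi).ne]
      simp only [hE']
      rw [h₀ C hCd hC', Finset.sum_congr rfl fun k _ => h k C hCd hC']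
      have hadd : ∀ k, (fun l => addTime A k n l ∪ C l) =
          addTime (fun l => A l ∪ C l) k n := by
        intro k
        funext l
        ext i
        simp only [Finset.mem_union, mem_addTime]
        tauto
      simp only [hadd]
      -- When `C` leaves `n` free, the recursion for the zero at `n` cancels the sum over the
      -- positive states.
      change (signedMass H p c (fullConstraints m Z) _ -
        ∑ k, signedMass H p c (fullConstraints m Z) (addTime _ k n)) + _ = _
      ring

/-- Consistent cylinder probabilities on finite time horizons are realised by one probability
measure on sequences. -/
lemma exists_probabilityMeasure_of_finite_horizon {M : (Fin m → Finset ℕ) → ℝ}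
    (h : ∀ n : ℕ, ∃ ν : ProbabilityMeasure (ℕ → Fin (m + 1)),
      ∀ C : Fin m → Finset ℕ, (∀ k l, k ≠ l → Disjoint (C k) (C l)) →
        (∀ k, ∀ i ∈ C k, i < n) →
        (ν : Measure (ℕ → Fin (m + 1))).real (stateEvent (fun i x => x i) C) = M C) :
    ∃ ν : ProbabilityMeasure (ℕ → Fin (m + 1)),
      ∀ C : Fin m → Finset ℕ, (∀ k l, k ≠ l → Disjoint (C k) (C l)) →
        (ν : Measure (ℕ → Fin (m + 1))).real (stateEvent (fun i x => x i) C) = M C := by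
  choose ν hν using h
  -- Along an ultrafilter a cluster point is a limit, so no subsequence is needed.
  obtain ⟨μ, hμ⟩ := exists_clusterPt_of_compactSpace ((hyperfilter ℕ : Filter ℕ).map ν)
  have hlim : Tendsto ν (hyperfilter ℕ : Filter ℕ) (𝓝 μ) := by
    have h1 : ClusterPt μ (((hyperfilter ℕ).map ν : Ultrafilter _) : Filter _) := hμ
    exact Ultrafilter.clusterPt_iff.1 h1
  refine ⟨μ, fun C hC => ?_⟩
  set E : Set (ℕ → Fin (m + 1)) := stateEvent (fun i x => x i) C with hE
  -- Clopen cylinders have empty boundary, so weak convergence preserves their probabilities.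
  have hclopen : IsClopen E := by
    have : E = ⋂ k, ⋂ i ∈ C k, {x : ℕ → Fin (m + 1) | x i = k.succ} := by
      ext x; simp [hE, stateEvent]
    rw [this]
    refine isClopen_iInter_of_finite fun k => (C k).finite_toSet.isClopen_biInter fun i _ => ?_
    exact (isClopen_discrete {k.succ}).preimage (continuous_apply i)
  have h2 := ProbabilityMeasure.tendsto_measure_of_null_frontier_of_tendsto' hlim
    (E := E) (by rw [hclopen.frontier_eq, measure_empty])
  have h3 : Tendsto (fun n => (ν n : Measure (ℕ → Fin (m + 1))).real E)
      (hyperfilter ℕ : Filter ℕ) (𝓝 ((μ : Measure (ℕ → Fin (m + 1))).real E)) :=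
    (ENNReal.tendsto_toReal (measure_ne_top _ _)).comp h2
  have h4 : (fun n => (ν n : Measure (ℕ → Fin (m + 1))).real E) =ᶠ[(hyperfilter ℕ : Filter ℕ)]
      fun _ => M C := by
    have h5 : ∀ᶠ n in atTop, (ν n : Measure (ℕ → Fin (m + 1))).real E = M C := by
      refine eventually_atTop.2 ⟨(Finset.univ.biUnion C).sup id + 1, fun n hn => ?_⟩
      refine hν n C hC fun k i hi => ?_
      have : i ≤ (Finset.univ.biUnion C).sup id := Finset.le_sup (f := id)
        (Finset.mem_biUnion.2 ⟨k, Finset.mem_univ k, hi⟩)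
      omega
    exact (Nat.hyperfilter_le_atTop) h5
  exact tendsto_nhds_unique h3 (tendsto_const_nhds.congr' h4.symm)

lemma LStar_empty (H p c : ℝ) : LStar H p c ∅ = 1 := rfl

lemma hasFiniteDimLaw_of_positive {Ω : Type*} [MeasurableSpace Ω] {P : Measure Ω}
    [IsFiniteMeasure P] {X : ℕ → Ω → Fin (m + 1)} (hX : ∀ i, Measurable (X i))
    (hpos : ∀ A : Fin m → Finset ℕ, (∀ k l, k ≠ l → Disjoint (A k) (A l)) →
      P.real (stateEvent X A) = LStarVec H p c A) : HasFiniteDimLaw H p c P X where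
  positive := hpos
  joint := fun Z A _ hZ hA => joint_of_positive hX hpos Z A hZ hA
  single := by
    intro k A
    have h := hpos (Function.update (fun _ => ∅) k A) (by
      intro a b hab
      by_cases ha : a = k
      · subst ha; simp [Function.update_of_ne hab.symm]
      · simp [Function.update_of_ne ha])
    rw [LStarVec, Finset.prod_eq_single k (fun l _ hl => by
      rw [Function.update_of_ne hl, LStar_empty]) (by simp), Function.update_self] at h
    rw [← h]
    congr 1
    ext ω
    simp only [stateEvent, Set.mem_ofPred_eq]
    constructor
    · intro hω l i hi
      by_cases hl : l = k
      · subst hl; exact hω i (by simpa using hi)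
      · simp [Function.update_of_ne hl] at hi
    · exact fun hω i hi => hω k i (by simpa using hi)

lemma exists_process (hH : ∀ k, H k < 1) (hp : ∀ k, 0 < p k) (hc : ∀ k, 0 < c k)
    (hb : ∑ k, gapWeight (H k) (p k) (c k) 0 1 * gapWeight (H k) (p k) (c k) 1 2 /
      gapWeight (H k) (p k) (c k) 0 2 ≤ 1) :
    ∃ (Ω : Type) (_ : MeasurableSpace Ω) (P : Measure Ω) (X : ℕ → Ω → Fin (m + 1)),
      IsProbabilityMeasure P ∧ (∀ i, Measurable (X i)) ∧ HasFiniteDimLaw H p c P X := by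
  have hb' : ∀ (A : Fin m → Finset ℕ) (w : ℕ),
      ∑ k, insertRatio (H k) (p k) (c k) (A k) w ≤ 1 := fun A w =>
    (Finset.sum_le_sum fun k _ => insertRatio_le (hH k) (hp k) (hc k) (A k) w).trans hb
  obtain ⟨ν, hν⟩ := exists_probabilityMeasure_of_finite_horizon (m := m)
    (M := LStarVec H p c) (by
      intro n
      obtain ⟨ν, hν, h⟩ := exists_measure_stateEvent (H := H) (p := p) (c := c)
        (fun Z A hf => signedMass_nonneg hH hp hc hb' _ _ A rfl hf) n [] (fun _ => ∅)
        ⟨by simp [fullConstraints], by simp [fullConstraints]⟩ (by simp) (by simp)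
      have hprob : IsProbabilityMeasure ν := by
        have h1 := h (fun _ => ∅) (by simp) (by simp)
        have hE : stateEvent (fun i (x : ℕ → Fin (m + 1)) => x i) (fun _ => ∅) = Set.univ := by
          ext x; simp [stateEvent]
        rw [hE] at h1
        refine ⟨(ENNReal.toReal_eq_one_iff _).1 (h1.trans ?_)⟩
        simp [fullConstraints, signedMass, LStarVec, LStar_empty]
      refine ⟨⟨ν, hprob⟩, fun C hC hCn => ?_⟩
      refine (h C hC hCn).trans ?_
      simp [fullConstraints, signedMass])
  exact ⟨ℕ → Fin (m + 1), inferInstance, ν, fun i x => x i, inferInstance,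
    fun i => measurable_pi_apply i,
    hasFiniteDimLaw_of_positive (fun i => measurable_pi_apply i) hν⟩

end Existence

/-! ### Stationarity -/

section Stationarity

variable {m : ℕ} {H p c : Fin m → ℝ}

lemma predGap_map_add (A : Finset ℕ) (h i : ℕ) :
    predGap (A.map (addRightEmbedding h)) (i + h) = predGap A i := by
  rw [predGap, Finset.filter_map, Finset.inf_map, predGap]
  simp only [Function.comp_def, addRightEmbedding_apply, add_lt_add_iff_right,
    Nat.add_sub_add_right]

lemma LStar_map_add (H p c : ℝ) (A : Finset ℕ) (h : ℕ) :
    LStar H p c (A.map (addRightEmbedding h)) = LStar H p c A := by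
  simp only [LStar, stepWeight_eq, Finset.prod_map, addRightEmbedding_apply, predGap_map_add]

lemma measureReal_stateEvent_add {Ω : Type*} [MeasurableSpace Ω] {P : Measure Ω}
    {X : ℕ → Ω → Fin (m + 1)}
    (hpos : ∀ A : Fin m → Finset ℕ, (∀ k l, k ≠ l → Disjoint (A k) (A l)) →
      P.real (stateEvent X A) = LStarVec H p c A) (h : ℕ)
    (A : Fin m → Finset ℕ) (hA : ∀ k l, k ≠ l → Disjoint (A k) (A l)) :
    P.real (stateEvent (fun i => X (i + h)) A) = LStarVec H p c A := by
  have h1 := hpos (fun k => (A k).map (addRightEmbedding h))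
    (fun k l hkl => (Finset.disjoint_map _).2 (hA k l hkl))
  simp only [LStarVec, LStar_map_add] at h1
  rw [LStarVec, ← h1]
  congr 1
  ext ω
  simp [stateEvent]

/-- Two processes with the same probabilities of positive states have the same law. -/
lemma identDistrib_of_positive {Ω : Type*} [MeasurableSpace Ω] {P : Measure Ω}
    [IsFiniteMeasure P] {X Y : ℕ → Ω → Fin (m + 1)}
    (hX : ∀ i, Measurable (X i)) (hY : ∀ i, Measurable (Y i))
    (hposX : ∀ A : Fin m → Finset ℕ, (∀ k l, k ≠ l → Disjoint (A k) (A l)) →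
      P.real (stateEvent X A) = LStarVec H p c A)
    (hposY : ∀ A : Fin m → Finset ℕ, (∀ k l, k ≠ l → Disjoint (A k) (A l)) →
      P.real (stateEvent Y A) = LStarVec H p c A) {n : ℕ} (t : Fin n → ℕ) :
    IdentDistrib (fun ω r => Y (t r) ω) (fun ω r => X (t r) ω) P P := by
  have hXm : Measurable fun ω r => X (t r) ω := measurable_pi_lambda _ fun r => hX (t r)
  have hYm : Measurable fun ω r => Y (t r) ω := measurable_pi_lambda _ fun r => hY (t r)
  refine ⟨hYm.aemeasurable, hXm.aemeasurable, ext_iff_measureReal_singleton.2 fun s => ?_⟩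
  rw [map_measureReal_apply hYm (measurableSet_singleton s),
    map_measureReal_apply hXm (measurableSet_singleton s)]
  -- The times `t r` may repeat; conflicting values at one time give the empty event for both
  -- processes.
  by_cases hcons : ∀ r r', t r = t r' → s r = s r'
  · set Z : Finset ℕ := (Finset.univ.filter fun r => s r = 0).image t with hZ
    set A : Fin m → Finset ℕ := fun k => (Finset.univ.filter fun r => s r = k.succ).image t
      with hA
    have hev : ∀ W : ℕ → Ω → Fin (m + 1), (fun ω r => W (t r) ω) ⁻¹' {s} =
        {ω | (∀ i ∈ Z, W i ω = 0) ∧ ∀ k, ∀ i ∈ A k, W i ω = k.succ} := by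
      intro W
      ext ω
      simp only [hZ, hA, Set.mem_preimage, Set.mem_singleton_iff, Set.mem_ofPred_eq,
        Finset.mem_image, Finset.mem_filter, Finset.mem_univ, true_and, forall_exists_index,
        and_imp, funext_iff]
      constructor
      · intro h
        refine ⟨?_, ?_⟩
        · rintro i r hr rfl
          rw [h r, hr]
        · rintro k i r hr rfl
          rw [h r, hr]
      · rintro ⟨h0, h1⟩ r
        rcases Fin.eq_zero_or_eq_succ (s r) with hr | ⟨k, hr⟩
        · rw [hr]; exact h0 _ r hr rfl
        · rw [hr]; exact h1 k _ r hr rfl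
    have hZA : ∀ k, Disjoint Z (A k) := by
      intro k
      rw [Finset.disjoint_left]
      intro i hi hj
      obtain ⟨r, hr, rfl⟩ := Finset.mem_image.1 hi
      obtain ⟨r', hr', hrr⟩ := Finset.mem_image.1 hj
      have h1 := (Finset.mem_filter.1 hr).2
      rw [← hcons r' r hrr, (Finset.mem_filter.1 hr').2] at h1
      exact Fin.succ_ne_zero k h1
    have hAA : ∀ k l, k ≠ l → Disjoint (A k) (A l) := by
      intro k l hkl
      rw [Finset.disjoint_left]
      intro i hi hj
      obtain ⟨r, hr, rfl⟩ := Finset.mem_image.1 hi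
      obtain ⟨r', hr', hrr⟩ := Finset.mem_image.1 hj
      have h1 := (Finset.mem_filter.1 hr).2
      rw [← hcons r' r hrr, (Finset.mem_filter.1 hr').2] at h1
      exact hkl (Fin.succ_injective m h1).symm
    rw [hev, hev, joint_of_positive hX hposX Z A hZA hAA, joint_of_positive hY hposY Z A hZA hAA]
  · push Not at hcons
    obtain ⟨r, r', htr, hsr⟩ := hcons
    have hev : ∀ W : ℕ → Ω → Fin (m + 1), (fun ω r => W (t r) ω) ⁻¹' {s} = ∅ := by
      intro W
      refine Set.eq_empty_of_forall_notMem fun ω hω => hsr ?_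
      have h1 := congrFun (Set.mem_singleton_iff.1 hω)
      rw [← h1 r, ← h1 r']
      exact congrArg (fun i => W i ω) htr
    rw [hev, hev]

lemma HasFiniteDimLaw.isStationaryProcess {Ω : Type*} [MeasurableSpace Ω] {P : Measure Ω}
    [IsFiniteMeasure P] {X : ℕ → Ω → Fin (m + 1)} (hX : ∀ i, Measurable (X i))
    (hlaw : HasFiniteDimLaw H p c P X) : IsStationaryProcess P X := fun _ t h =>
  identDistrib_of_positive (Y := fun i => X (i + h)) hX (fun i => hX (i + h)) hlaw.positive
    (measureReal_stateEvent_add hlaw.positive h) t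

lemma stateIndicator_apply {Ω S : Type*} [DecidableEq S] (X : ℕ → Ω → S) (a : S) (i : ℕ)
    (ω : Ω) : stateIndicator X a i ω = if X i ω = a then 1 else 0 := by
  simp [stateIndicator, Set.indicator_apply]

lemma IsStationaryProcess.stateIndicator {Ω : Type*} [MeasurableSpace Ω] {P : Measure Ω}
    {X : ℕ → Ω → Fin (m + 1)} (hX : IsStationaryProcess P X) (a : Fin (m + 1)) :
    IsStationaryProcess P (stateIndicator X a) := by
  intro n t h
  have hg : Measurable fun (x : Fin n → Fin (m + 1)) r => if x r = a then (1 : ℝ) else 0 :=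
    measurable_of_finite _
  have h1 := (hX n t h).comp hg
  simp only [Function.comp_def] at h1
  simpa only [stateIndicator_apply] using h1

end Stationarity

/-! ### Marginals and covariances -/

section Covariance

variable {m : ℕ} {H p c : Fin m → ℝ}

lemma LStar_singleton (H p c : ℝ) (i : ℕ) : LStar H p c {i} = p := by
  simp [LStar, stepWeight_eq, predGap, Finset.filter_singleton]

lemma LStar_pair (H p c : ℝ) {i j : ℕ} (hij : i ≠ j) :
    LStar H p c {i, j} = p * (p + c * |(i : ℝ) - (j : ℝ)| ^ (2 * H - 2)) := by
  wlog h : i < j generalizing i j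
  · rw [Finset.pair_comm, this hij.symm (by omega), abs_sub_comm]
  · rw [LStar, Finset.prod_pair hij, stepWeight_eq, stepWeight_eq]
    have h1 : predGap {i, j} i = ⊤ := by
      simp [predGap, Finset.filter_insert, Finset.filter_singleton, h.not_gt]
    have h2 : predGap {i, j} j = ((j - i : ℕ) : ℕ∞) := by
      simp [predGap, Finset.filter_insert, Finset.filter_singleton, h]
    rw [h1, h2, gapWeightTop_top, gapWeightTop_coe, Nat.cast_sub h.le, abs_sub_comm, abs_of_nonneg]
    exact sub_nonneg.2 (Nat.cast_le.2 h.le)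

variable {Ω : Type*} [MeasurableSpace Ω] {P : Measure Ω} {X : ℕ → Ω → Fin (m + 1)}

lemma HasFiniteDimLaw.measureReal_succ (hlaw : HasFiniteDimLaw H p c P X) (i : ℕ) (k : Fin m) :
    P.real {ω | X i ω = k.succ} = p k := by
  simpa [LStar_singleton] using hlaw.single k {i}

lemma HasFiniteDimLaw.measureReal_zero [IsProbabilityMeasure P] (hX : ∀ i, Measurable (X i))
    (hlaw : HasFiniteDimLaw H p c P X) (i : ℕ) :
    P.real {ω | X i ω = 0} = 1 - ∑ k, p k := by
  have h := measureReal_inter_zero P (hX i) Set.univ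
  simpa [hlaw.measureReal_succ] using h

lemma HasFiniteDimLaw.measureReal_pair (hlaw : HasFiniteDimLaw H p c P X) {i j : ℕ} (hij : i ≠ j)
    (k l : Fin m) :
    P.real ({ω | X i ω = k.succ} ∩ {ω | X j ω = l.succ}) =
      p k * p l + if k = l then p k * c k * |(i : ℝ) - (j : ℝ)| ^ (2 * H k - 2) else 0 := by
  split_ifs with hkl
  · subst hkl
    have h := hlaw.single k {i, j}
    rw [LStar_pair _ _ _ hij] at h
    have hE : {ω | X i ω = k.succ} ∩ {ω | X j ω = k.succ} =
        {ω | ∀ i' ∈ ({i, j} : Finset ℕ), X i' ω = k.succ} := by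
      ext ω; simp
    rw [hE, h]
    ring
  · set A : Fin m → Finset ℕ := fun a => if a = k then {i} else if a = l then {j} else ∅
      with hA
    have hAk : A k = {i} := by simp [hA]
    have hAl : A l = {j} := by simp [hA, Ne.symm hkl]
    have hA0 : ∀ a, a ≠ k → a ≠ l → A a = ∅ := fun a h1 h2 => by simp [hA, h1, h2]
    have h := hlaw.positive A (by
      intro a b hab
      rw [Finset.disjoint_left]
      intro z hz hz'
      simp only [hA] at hz hz'
      split_ifs at hz hz' <;> simp_all)
    rw [Finset.prod_eq_mul k l hkl (fun a _ ha => by rw [hA0 a ha.1 ha.2, LStar_empty])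
      (by simp) (by simp), hAk, hAl, LStar_singleton, LStar_singleton] at h
    rw [add_zero, ← h]
    congr 1
    ext ω
    simp only [Set.mem_inter_iff, Set.mem_ofPred_eq]
    constructor
    · rintro ⟨h1, h2⟩ a z hz
      by_cases hak : a = k
      · subst hak
        rw [hAk, Finset.mem_singleton] at hz
        rw [hz, h1]
      · by_cases hal : a = l
        · subst hal
          rw [hAl, Finset.mem_singleton] at hz
          rw [hz, h2]
        · simp [hA0 a hak hal] at hz
    · exact fun h => ⟨h k i (by simp [hAk]), h l j (by simp [hAl])⟩

lemma memLp_comp [IsFiniteMeasure P] (hX : ∀ i, Measurable (X i)) (f : Fin (m + 1) → ℝ) (i : ℕ) :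
    MemLp (fun ω => f (X i ω)) 2 P := by
  refine MemLp.of_bound ((measurable_of_finite f).comp (hX i)).aestronglyMeasurable
    (∑ a, ‖f a‖) (ae_of_all _ fun ω => ?_)
  exact Finset.single_le_sum (f := fun a => ‖f a‖) (fun a _ => norm_nonneg _)
    (Finset.mem_univ (X i ω))

lemma memLp_stateIndicator [IsFiniteMeasure P] (hX : ∀ i, Measurable (X i)) (a : Fin (m + 1))
    (i : ℕ) : MemLp (stateIndicator X a i) 2 P := by
  have h := memLp_comp (P := P) hX (fun b => if b = a then 1 else 0) i
  convert! h using 2 with ω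
  exact stateIndicator_apply X a i ω

/-- For distinct states the joint probability factorises, because `L*` is a product over states. -/
lemma HasFiniteDimLaw.covariance_stateIndicator [IsProbabilityMeasure P]
    (hX : ∀ i, Measurable (X i)) (hlaw : HasFiniteDimLaw H p c P X) {i j : ℕ} (hij : i ≠ j)
    (k l : Fin m) :
    cov[stateIndicator X k.succ i, stateIndicator X l.succ j; P] =
      if k = l then p k * c k * |(i : ℝ) - (j : ℝ)| ^ (2 * H k - 2) else 0 := by
  have hmeas : ∀ (a : Fin (m + 1)) (i : ℕ), MeasurableSet {ω | X i ω = a} := fun a i =>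
    hX i (measurableSet_singleton a)
  have hprod : stateIndicator X k.succ i * stateIndicator X l.succ j =
      Set.indicator ({ω | X i ω = k.succ} ∩ {ω | X j ω = l.succ}) (fun _ => (1 : ℝ)) := by
    funext ω
    simp only [Pi.mul_apply, stateIndicator, Set.indicator_apply, Set.mem_inter_iff,
      Set.mem_ofPred_eq]
    split_ifs <;> simp_all
  have hint : ∀ (a : Fin m) (i : ℕ), ∫ ω, stateIndicator X a.succ i ω ∂P = p a := by
    intro a i
    rw [stateIndicator, integral_indicator_const _ (hmeas _ _), hlaw.measureReal_succ]
    simp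
  rw [covariance_eq_sub (memLp_stateIndicator hX _ _) (memLp_stateIndicator hX _ _), hprod,
    hint, hint, integral_indicator_const _ ((hmeas _ _).inter (hmeas _ _)),
    hlaw.measureReal_pair hij]
  simp

/-- The covariances of an arbitrary function of the process. -/
lemma HasFiniteDimLaw.covariance_comp [IsProbabilityMeasure P]
    (hX : ∀ i, Measurable (X i)) (hlaw : HasFiniteDimLaw H p c P X) (f : Fin (m + 1) → ℝ)
    {i j : ℕ} (hij : i ≠ j) :
    cov[fun ω => f (X i ω), fun ω => f (X j ω); P] =
      ∑ k : Fin m, (f k.succ - f 0) ^ 2 * (p k * c k) *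
        |(i : ℝ) - (j : ℝ)| ^ (2 * H k - 2) := by
  -- State 0 serves as reference level, so only indicators of positive states occur and the cross
  -- terms vanish.
  have hrep : ∀ i, (fun ω => f (X i ω)) =
      fun ω => f 0 + ∑ k : Fin m, (f k.succ - f 0) * stateIndicator X k.succ i ω := by
    intro i
    funext ω
    simp only [stateIndicator_apply]
    rcases Fin.eq_zero_or_eq_succ (X i ω) with h | ⟨k, h⟩
    · simp [h, (Fin.succ_ne_zero _).symm]
    · simp [h]
  have hmem : ∀ i (k : Fin m),
      MemLp (fun ω => (f k.succ - f 0) * stateIndicator X k.succ i ω) 2 P := fun i k =>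
    (memLp_stateIndicator hX _ _).const_mul _
  have hsum : ∀ i, MemLp
      (fun ω => ∑ k : Fin m, (f k.succ - f 0) * stateIndicator X k.succ i ω) 2 P := fun i =>
    memLp_finsetSum _ fun k _ => hmem i k
  rw [hrep i, hrep j, covariance_const_add_left ((hsum i).integrable one_le_two),
    covariance_const_add_right ((hsum j).integrable one_le_two),
    covariance_fun_sum_left (hmem i) (hsum j)]
  refine Finset.sum_congr rfl fun k _ => ?_
  rw [covariance_fun_sum_right (hmem j) (hmem i k), Finset.sum_eq_single k]
  · rw [covariance_const_mul_left, covariance_const_mul_right,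
      hlaw.covariance_stateIndicator hX hij, if_pos rfl]
    ring
  · intro l _ hl
    rw [covariance_const_mul_left, covariance_const_mul_right,
      hlaw.covariance_stateIndicator hX hij, if_neg hl.symm]
    ring
  · simp

lemma HasFiniteDimLaw.covariance_zero [IsProbabilityMeasure P]
    (hX : ∀ i, Measurable (X i)) (hlaw : HasFiniteDimLaw H p c P X) {i j : ℕ} (hij : i ≠ j) :
    cov[stateIndicator X 0 i, stateIndicator X 0 j; P] =
      ∑ k : Fin m, p k * c k * |(i : ℝ) - (j : ℝ)| ^ (2 * H k - 2) := by
  have h := hlaw.covariance_comp hX (fun a => if a = 0 then 1 else 0) hij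
  have hI : ∀ i, stateIndicator X 0 i = fun ω => if X i ω = 0 then 1 else 0 := fun i =>
    funext fun ω => stateIndicator_apply X 0 i ω
  rw [hI, hI, h]
  simp

lemma HasFiniteDimLaw.covariance_realProcess [IsProbabilityMeasure P]
    (hX : ∀ i, Measurable (X i)) (hlaw : HasFiniteDimLaw H p c P X) {i j : ℕ} (hij : i ≠ j) :
    cov[realProcess X i, realProcess X j; P] =
      ∑ k : Fin m, ((k : ℝ) + 1) ^ 2 * p k * c k * |(i : ℝ) - (j : ℝ)| ^ (2 * H k - 2) := by
  have h := hlaw.covariance_comp hX (fun a => ((a : ℕ) : ℝ)) hij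
  refine h.trans (Finset.sum_congr rfl fun k _ => ?_)
  simp [mul_assoc]

end Covariance

/-! ### Asymptotics, long-range dependence and the Hurst index -/

section Asymptotics

/-- The terms with maximal `H` form the right side exactly; every other term is of smaller order. -/
lemma isEquivalent_sum_rpow {ι : Type*} [Fintype ι] {a H : ι → ℝ} (ha : ∀ k, 0 < a k) {k' : ι}
    (hk' : ∀ k, H k ≤ H k') :
    Asymptotics.IsEquivalent atTop (fun x : ℝ => ∑ k, a k * x ^ (2 * H k - 2))
      (fun x => (∑ k with H k = H k', a k) * x ^ (2 * H k' - 2)) := by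
  have hC : (∑ k with H k = H k', a k) ≠ 0 :=
    (Finset.sum_pos (fun k _ => ha k) ⟨k', by simp⟩).ne'
  have hdiff : (fun x : ℝ => ∑ k, a k * x ^ (2 * H k - 2)) -
      (fun x => (∑ k with H k = H k', a k) * x ^ (2 * H k' - 2)) =
      fun x => ∑ k with ¬ H k = H k', a k * x ^ (2 * H k - 2) := by
    funext x
    rw [Pi.sub_apply, ← Finset.sum_filter_add_sum_filter_not Finset.univ (fun k => H k = H k'),
      Finset.sum_mul, add_sub_right_comm, add_eq_right, sub_eq_zero]
    exact Finset.sum_congr rfl fun k hk => by rw [(Finset.mem_filter.1 hk).2]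
  rw [Asymptotics.IsEquivalent, hdiff, Asymptotics.isLittleO_const_mul_right_iff hC]
  refine Asymptotics.IsLittleO.fun_sum fun k hk => ?_
  have hlt : H k < H k' := lt_of_le_of_ne (hk' k) (Finset.mem_filter.1 hk).2
  refine Asymptotics.IsLittleO.const_mul_left ?_ _
  refine (Asymptotics.isLittleO_iff_tendsto' ?_).2 ?_
  · filter_upwards [eventually_gt_atTop 0] with x hx h0
    exact absurd h0 (Real.rpow_pos_of_pos hx _).ne'
  · refine (tendsto_rpow_neg_atTop (y := 2 * (H k' - H k)) (by linarith)).congr' ?_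
    filter_upwards [eventually_gt_atTop 0] with x hx
    rw [← Real.rpow_sub hx]
    congr 1
    ring

lemma isEquivalent_lagAtTop {f : ℕ × ℕ → ℝ} {g h : ℝ → ℝ}
    (hgh : Asymptotics.IsEquivalent atTop g h)
    (hf : ∀ i j : ℕ, i ≠ j → f (i, j) = g |(i : ℝ) - (j : ℝ)|) :
    Asymptotics.IsEquivalent lagAtTop f (fun q => h |(q.1 : ℝ) - (q.2 : ℝ)|) := by
  have hlag : Tendsto (fun q : ℕ × ℕ => |(q.1 : ℝ) - (q.2 : ℝ)|) lagAtTop atTop :=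
    tendsto_comap
  refine (hgh.comp_tendsto hlag).congr_left ?_
  filter_upwards [hlag.eventually_gt_atTop 0] with q hq
  refine (hf q.1 q.2 fun h => ?_).symm
  simp [h] at hq

/-! ### Partial sums of covariances with power bounds -/

variable {γ : ℕ → ℝ} {a b η : ℝ}

lemma not_summable_of_rpow_le (ha : 0 < a) (hη : 1 / 2 < η) (hη1 : η < 1) (h0 : 0 ≤ γ 0)
    (hlow : ∀ n : ℕ, n ≠ 0 → a * (n : ℝ) ^ (2 * η - 2) ≤ γ n) : ¬ Summable γ := by
  intro hγ
  have hle : ∀ n : ℕ, a * (n : ℝ) ^ (2 * η - 2) ≤ γ n := by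
    intro n
    rcases eq_or_ne n 0 with rfl | hn
    -- The exponent is nonzero, so the power vanishes at 0 and the comparison extends to `n = 0`.
    · rw [Nat.cast_zero, Real.zero_rpow (by linarith), mul_zero]
      exact h0
    · exact hlow n hn
  have h1 : Summable fun n : ℕ => a * (n : ℝ) ^ (2 * η - 2) :=
    Summable.of_nonneg_of_le (fun n => by positivity) hle hγ
  have h2 := Real.summable_nat_rpow.1 ((summable_mul_left_iff ha.ne').1 h1)
  linarith

/-- Each of the last n - 1 ≥ n/2 summands is at least a n^(2η-2), so the normalised sum is at least
(a/2) n^(2(η-h)). -/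
lemma limsup_partial_sums_eq_top (ha : 0 < a) (hη1 : η < 1) (h0 : 0 ≤ γ 0)
    (hlow : ∀ n : ℕ, n ≠ 0 → a * (n : ℝ) ^ (2 * η - 2) ≤ γ n) {h : ℝ} (hh : h < η) :
    limsup (fun n : ℕ =>
      (((n : ℝ) ^ (-2 * h + 1) * ∑ j ∈ Finset.range n, γ j : ℝ) : EReal)) atTop = ⊤ := by
  refine Tendsto.limsup_eq (EReal.tendsto_coe_nhds_top_iff.2 ?_)
  have h1 : Tendsto (fun n : ℕ => a / 2 * (n : ℝ) ^ (2 * (η - h))) atTop atTop :=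
    ((tendsto_rpow_atTop (by linarith)).comp tendsto_natCast_atTop_atTop).const_mul_atTop
      (by positivity)
  refine tendsto_atTop_mono' _ ?_ h1
  filter_upwards [eventually_ge_atTop 2] with n hn
  obtain ⟨N, rfl⟩ : ∃ N, n = N + 1 := ⟨n - 1, by omega⟩
  set x : ℝ := ((N + 1 : ℕ) : ℝ) with hx
  have hN : (1 : ℝ) ≤ N := by exact_mod_cast (by omega : 1 ≤ N)
  have hxN : x = N + 1 := by rw [hx]; push_cast; ring
  have hx0 : 0 < x := by linarith
  have hterm : ∀ j ∈ Finset.range N, a * x ^ (2 * η - 2) ≤ γ (j + 1) := by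
    intro j hj
    refine le_trans ?_ (hlow (j + 1) (Nat.succ_ne_zero j))
    refine mul_le_mul_of_nonneg_left ?_ ha.le
    refine Real.rpow_le_rpow_of_nonpos (by positivity) ?_ (by linarith)
    exact Nat.cast_le.2 (by have := Finset.mem_range.1 hj; omega)
  have hsum : x / 2 * (a * x ^ (2 * η - 2)) ≤ ∑ j ∈ Finset.range (N + 1), γ j := by
    rw [Finset.sum_range_succ']
    have h2 := Finset.card_nsmul_le_sum _ _ _ hterm
    rw [Finset.card_range, nsmul_eq_mul] at h2
    have h3 : x / 2 * (a * x ^ (2 * η - 2)) ≤ N * (a * x ^ (2 * η - 2)) :=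
      mul_le_mul_of_nonneg_right (by linarith) (by positivity)
    linarith
  have h4 := mul_le_mul_of_nonneg_left hsum (Real.rpow_nonneg hx0.le (-2 * h + 1))
  refine le_trans (le_of_eq ?_) h4
  have h5 : x ^ (2 * (η - h)) = x ^ (-2 * h + 1) * (x * x ^ (2 * η - 2)) := by
    have h6 : x * x ^ (2 * η - 2) = x ^ (1 + (2 * η - 2)) := by
      rw [Real.rpow_add hx0, Real.rpow_one]
    rw [h6, ← Real.rpow_add hx0]
    congr 1
    ring
  rw [h5]
  ring

/-- Since `h > 1/2`, the factor n^(1-2h) is at most j^(1-2h) for 1 ≤ j ≤ n. Moved inside the sum, it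
leaves the convergent series of j^(2η-2h-1). -/
lemma limsup_partial_sums_lt_top (hb : 0 ≤ b) (hη : 1 / 2 < η) (h0 : 0 ≤ γ 0)
    (hup : ∀ n : ℕ, n ≠ 0 → γ n ≤ b * (n : ℝ) ^ (2 * η - 2)) {h : ℝ} (hh : η < h) :
    limsup (fun n : ℕ =>
      (((n : ℝ) ^ (-2 * h + 1) * ∑ j ∈ Finset.range n, γ j : ℝ) : EReal)) atTop < ⊤ := by
  have hs : Summable fun j : ℕ => (j : ℝ) ^ (2 * η - 2 * h - 1) :=
    Real.summable_nat_rpow.2 (by linarith)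
  set T := ∑' j : ℕ, (j : ℝ) ^ (2 * η - 2 * h - 1) with hT
  refine lt_of_le_of_lt (b := ((γ 0 + b * T : ℝ) : EReal)) ?_ (EReal.coe_lt_top _)
  refine limsup_le_of_le (by isBoundedDefault) (Eventually.of_forall fun n => ?_)
  rw [EReal.coe_le_coe_iff]
  have hT0 : 0 ≤ T := tsum_nonneg fun j => by positivity
  cases n with
  | zero => simp only [Finset.range_zero, Finset.sum_empty, mul_zero]; positivity
  | succ N =>
    have hx1 : (1 : ℝ) ≤ ((N + 1 : ℕ) : ℝ) := by exact_mod_cast Nat.succ_le_succ (Nat.zero_le N)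
    set x : ℝ := ((N + 1 : ℕ) : ℝ) with hx
    have hexp : -2 * h + 1 ≤ 0 := by linarith
    have hterm : ∀ j ∈ Finset.range N, x ^ (-2 * h + 1) * γ (j + 1) ≤
        b * ((j + 1 : ℕ) : ℝ) ^ (2 * η - 2 * h - 1) := by
      intro j hj
      have hj0 : (0 : ℝ) < ((j + 1 : ℕ) : ℝ) := by positivity
      have hjx : ((j + 1 : ℕ) : ℝ) ≤ x := by
        exact Nat.cast_le.2 (by have := Finset.mem_range.1 hj; omega)
      have h1 := Real.rpow_le_rpow_of_nonpos hj0 hjx hexp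
      calc x ^ (-2 * h + 1) * γ (j + 1)
          ≤ x ^ (-2 * h + 1) * (b * ((j + 1 : ℕ) : ℝ) ^ (2 * η - 2)) :=
            mul_le_mul_of_nonneg_left (hup _ (Nat.succ_ne_zero j)) (by positivity)
        _ ≤ ((j + 1 : ℕ) : ℝ) ^ (-2 * h + 1) * (b * ((j + 1 : ℕ) : ℝ) ^ (2 * η - 2)) :=
            mul_le_mul_of_nonneg_right h1 (by positivity)
        _ = b * ((j + 1 : ℕ) : ℝ) ^ (2 * η - 2 * h - 1) := by
            rw [mul_left_comm, ← Real.rpow_add hj0]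
            congr 2
            ring
    have hsum : ∑ j ∈ Finset.range N, ((j + 1 : ℕ) : ℝ) ^ (2 * η - 2 * h - 1) ≤ T := by
      have h2 := hs.sum_le_tsum (Finset.range (N + 1)) fun j _ => by positivity
      rw [Finset.sum_range_succ'] at h2
      have h3 : 0 ≤ ((0 : ℕ) : ℝ) ^ (2 * η - 2 * h - 1) := by positivity
      linarith
    have h4 := Finset.sum_le_sum hterm
    rw [← Finset.mul_sum, ← Finset.mul_sum] at h4
    rw [Finset.sum_range_succ', mul_add]
    have h5 := mul_le_mul_of_nonneg_left hsum hb
    have h6 : x ^ (-2 * h + 1) * γ 0 ≤ γ 0 :=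
      mul_le_of_le_one_left h0 (Real.rpow_le_one_of_one_le_of_nonpos hx1 hexp)
    linarith

/-- Zero coefficients are allowed, and `H k'` need dominate only where the coefficient is nonzero;
thus a single state is covered even if its index is not maximal. -/
lemma isLongRangeDependent_and_isHurstIndex {Ω : Type*} [MeasurableSpace Ω] {P : Measure Ω}
    {Y : ℕ → Ω → ℝ} {m : ℕ} {A H : Fin m → ℝ} {k' : Fin m} (hA : ∀ k, 0 ≤ A k)
    (hA' : 0 < A k') (hmax : ∀ k, A k ≠ 0 → H k ≤ H k') (hη : 1 / 2 < H k') (hη1 : H k' < 1)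
    (hcov : ∀ n : ℕ, n ≠ 0 →
      cov[Y 0, Y n; P] = ∑ k, A k * (n : ℝ) ^ (2 * H k - 2)) :
    IsLongRangeDependent P Y ∧ IsHurstIndex P Y (H k') := by
  have h0 : 0 ≤ cov[Y 0, Y 0; P] := integral_nonneg fun ω => mul_self_nonneg _
  have hlow : ∀ n : ℕ, n ≠ 0 → A k' * (n : ℝ) ^ (2 * H k' - 2) ≤ cov[Y 0, Y n; P] := by
    intro n hn
    rw [hcov n hn]
    exact Finset.single_le_sum (f := fun k => A k * (n : ℝ) ^ (2 * H k - 2))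
      (fun k _ => mul_nonneg (hA k) (by positivity)) (Finset.mem_univ k')
  have hup : ∀ n : ℕ, n ≠ 0 → cov[Y 0, Y n; P] ≤ (∑ k, A k) * (n : ℝ) ^ (2 * H k' - 2) := by
    intro n hn
    rw [hcov n hn, Finset.sum_mul]
    refine Finset.sum_le_sum fun k _ => ?_
    rcases eq_or_ne (A k) 0 with hk | hk
    · simp [hk]
    · refine mul_le_mul_of_nonneg_left ?_ (hA k)
      refine Real.rpow_le_rpow_of_exponent_le ?_ (by linarith [hmax k hk])
      exact_mod_cast Nat.one_le_iff_ne_zero.2 hn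
  refine ⟨not_summable_of_rpow_le hA' hη hη1 h0 hlow, fun h hh => ?_, fun g hg => ?_⟩
  · by_contra! hlt
    exact (ne_of_lt hh) (limsup_partial_sums_eq_top hA' hη1 h0 hlow hlt)
  · refine le_of_forall_gt_imp_ge_of_dense fun h hh => hg ?_
    exact limsup_partial_sums_lt_top (Finset.sum_nonneg fun k _ => hA k) hη h0 hup hh

end Asymptotics

/-! ### The theorem -/

theorem theorem2p3 (m : ℕ) (H p c : Fin m → ℝ)
    (hH : ∀ k, 0 < H k ∧ H k < 1) (hp : ∀ k, 0 < p k ∧ p k < 1) (hc : ∀ k, 0 < c k ∧ c k < 1)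
    (hb : ∀ i₀ i₁ i₂ : ℕ, i₀ < i₁ → i₁ < i₂ →
      ∑ k, gapWeight (H k) (p k) (c k) i₀ i₁ * gapWeight (H k) (p k) (c k) i₁ i₂ /
        gapWeight (H k) (p k) (c k) i₀ i₂ < 1) :
    -- a process with the prescribed finite-dimensional probabilities exists
    (∃ (Ω : Type) (_ : MeasurableSpace Ω) (P : Measure Ω) (X : ℕ → Ω → Fin (m + 1)),
      IsProbabilityMeasure P ∧ (∀ i, Measurable (X i)) ∧ HasFiniteDimLaw H p c P X) ∧
    -- and every such process has all the listed properties
    (∀ (Ω : Type*) [MeasurableSpace Ω] (P : Measure Ω) [IsProbabilityMeasure P]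
      (X : ℕ → Ω → Fin (m + 1)), (∀ i, Measurable (X i)) → HasFiniteDimLaw H p c P X →
      -- the process and the indicator sequence of each state are stationary
      IsStationaryProcess P X ∧
      (∀ a, IsStationaryProcess P (stateIndicator X a)) ∧
      -- one-dimensional marginals
      (∀ i k, P.real {ω | X i ω = k.succ} = p k) ∧
      (∀ i, P.real {ω | X i ω = 0} = 1 - ∑ k, p k) ∧
      -- covariances of the indicators of the states 1, ..., m
      (∀ k i j, i ≠ j → cov[stateIndicator X k.succ i, stateIndicator X k.succ j; P] =
        p k * c k * |(i : ℝ) - (j : ℝ)| ^ (2 * H k - 2)) ∧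
      -- covariance of the indicators of the state 0: one maximizer of H
      (∀ k', (∀ k, k ≠ k' → H k < H k') →
        Asymptotics.IsEquivalent lagAtTop
          (fun q => cov[stateIndicator X 0 q.1, stateIndicator X 0 q.2; P])
          (fun q => p k' * c k' * |(q.1 : ℝ) - (q.2 : ℝ)| ^ (2 * H k' - 2))) ∧
      -- the same with several maximizers allowed
      (∀ k', (∀ k, H k ≤ H k') →
        Asymptotics.IsEquivalent lagAtTop
          (fun q => cov[stateIndicator X 0 q.1, stateIndicator X 0 q.2; P])
          (fun q => (∑ k with H k = H k', p k * c k) *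
            |(q.1 : ℝ) - (q.2 : ℝ)| ^ (2 * H k' - 2))) ∧
      -- covariances of the process
      (∀ i j, i ≠ j → cov[realProcess X i, realProcess X j; P] =
        ∑ k : Fin m, ((k : ℝ) + 1) ^ 2 * p k * c k * |(i : ℝ) - (j : ℝ)| ^ (2 * H k - 2)) ∧
      -- long-range dependence of the indicator sequences of the states 1, ..., m
      (∀ k, 1 / 2 < H k → IsLongRangeDependent P (stateIndicator X k.succ) ∧
        IsHurstIndex P (stateIndicator X k.succ) (H k)) ∧
      -- long-range dependence of the indicator sequence of the state 0 and of the process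
      (∀ k', (∀ k, H k ≤ H k') → 1 / 2 < H k' →
        (IsLongRangeDependent P (stateIndicator X 0) ∧
          IsHurstIndex P (stateIndicator X 0) (H k')) ∧
        (IsLongRangeDependent P (realProcess X) ∧ IsHurstIndex P (realProcess X) (H k')))) := by
  have hH1 : ∀ k, H k < 1 := fun k => (hH k).2
  have hp0 : ∀ k, 0 < p k := fun k => (hp k).1
  have hc0 : ∀ k, 0 < c k := fun k => (hc k).1
  have hpc : ∀ k, 0 < p k * c k := fun k => mul_pos (hp0 k) (hc0 k)
  refine ⟨exists_process hH1 hp0 hc0 (hb 0 1 2 (by norm_num) (by norm_num)).le, ?_⟩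
  intro Ω _ P _ X hX hlaw
  have hzero : ∀ k', (∀ k, H k ≤ H k') →
      Asymptotics.IsEquivalent lagAtTop
        (fun q => cov[stateIndicator X 0 q.1, stateIndicator X 0 q.2; P])
        (fun q => (∑ k with H k = H k', p k * c k) *
          |(q.1 : ℝ) - (q.2 : ℝ)| ^ (2 * H k' - 2)) := fun k' hk' =>
    isEquivalent_lagAtTop (isEquivalent_sum_rpow hpc hk') fun i j hij =>
      hlaw.covariance_zero hX hij
  have hlag : ∀ n : ℕ, |((0 : ℕ) : ℝ) - (n : ℝ)| = n := fun n => by simp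
  refine ⟨hlaw.isStationaryProcess hX, fun a => (hlaw.isStationaryProcess hX).stateIndicator a,
    hlaw.measureReal_succ, hlaw.measureReal_zero hX, fun k i j hij => ?_, fun k' hk' => ?_, hzero,
    fun i j hij => hlaw.covariance_realProcess hX hij, fun k hk => ?_,
    fun k' hk' hη => ⟨?_, ?_⟩⟩
  · rw [hlaw.covariance_stateIndicator hX hij, if_pos rfl]
  · have h := hzero k' fun k => by
      rcases eq_or_ne k k' with rfl | hk
      · exact le_rfl
      · exact (hk' k hk).le
    have hfilter : (Finset.univ.filter fun k => H k = H k') = {k'} := by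
      ext k
      rw [Finset.mem_filter, Finset.mem_singleton]
      refine ⟨fun hk => ?_, fun hk => by simp [hk]⟩
      by_contra hne
      exact (hk' k hne).ne hk.2
    rwa [hfilter, Finset.sum_singleton] at h
  · refine isLongRangeDependent_and_isHurstIndex (A := fun l => if l = k then p k * c k else 0)
      (fun l => ?_) (by simpa using hpc k) (fun l hl => ?_) hk (hH1 k) fun n hn => ?_
    · split_ifs
      · exact (hpc k).le
      · exact le_rfl
    · have : l = k := by
        by_contra hlk
        simp [hlk] at hl
      rw [this]
    · rw [hlaw.covariance_stateIndicator hX (Ne.symm hn), if_pos rfl, hlag]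
      simp
  · refine isLongRangeDependent_and_isHurstIndex (fun k => (hpc k).le) (hpc k')
      (fun k _ => hk' k) hη (hH1 k') fun n hn => ?_
    rw [hlaw.covariance_zero hX (Ne.symm hn), hlag]
  · have hA : ∀ k : Fin m, 0 < ((k : ℝ) + 1) ^ 2 * p k * c k := fun k => by
      have := hp0 k
      have := hc0 k
      positivity
    refine isLongRangeDependent_and_isHurstIndex (fun k => (hA k).le) (hA k')
      (fun k _ => hk' k) hη (hH1 k') fun n hn => ?_
    rw [hlaw.covariance_realProcess hX (Ne.symm hn), hlag]
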